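/- **Wavelet basis.** Let $\varphi,\psi$ be the scaling function and wavelet of an orthonormal multiresolution analysis of $L^2(\mathbb R)$, both supported in $[1-K,K]$, with $\varphi$ twice continuously differentiable and $\int x^i\psi(x)\,dx=0$ for $0\le i<N$. Let $j_0>0$ and let $\varphi_{j_0,k}$ ($0\le k<2^{j_0}$), $\psi_{j,k}$ ($j>j_0$, $0\le k<2^j$) be an orthonormal basis of $L^2([0,1])$ consisting of continuous functions such that, for $k\in[N,2^{j}-N)$ (with $j=j_0$ in the case of $\varphi_{j_0,k}$), $\varphi_{j_0,k}(x)=2^{j_0/2}\varphi(2^{j_0}x-k)$ and $\psi_{j,k}(x)=2^{j/2}\psi(2^jx-k)$ on $[0,1]$ (for example, a Cohen–Daubechies–Vial basis). **Function classes.** For $f$ with coefficients $\alpha_k=\int_0^1 f\varphi_{j_0,k}$, $\beta_{j,k}=\int_0^1 f\psi_{j,k}$, put $$\|f\|_{C^s}=\max\Bigl(\sup_k|\alpha_k|,\ \sup_{j>j_0,\,k}2^{j(s+1/2)}|\beta_{j,k}|\Bigr)\in[0,\infty],$$ and let $C^s(M)$ be the set of continuous $f:[0,1]\to\mathbb R$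 with $\|f\|_{C^s}\le M$. For $i>j_0$ let $f_{i,j}=\sum_{l=i}^{j}\sum_k\beta_{l,k}\psi_{l,k}$, and let $f_{j_0,j}=\sum_k\alpha_k\varphi_{j_0,k}+f_{j_0+1,j}$. Fix $s_{\max}\in(0,N)$, $\varepsilon\in(0,1)$ and positive integers $\rho_j$ $(j\ge j_0)$ with $\rho_j\to\infty$. For $s\in(0,s_{\max})$ and $M>0$ let $$C^s_1(M)=\bigl\{f\in C^s(M):\ \|f_{j,\rho_jj}\|_{C^s}\ge\varepsilon M\ \text{ for all } j\ge j_0\bigr\}.$$ **Model and bands.** In the white noise model one observes, for each $n$, the path $Y_t=\int_0^tf(u)\,du+n^{-1/2}B_t$, $t\in[0,1]$, where $B$ is a standard Brownian motion; its law is written $\mathbb P_f$. A confidence band is $C_n=\{g\in C([0,1]):\|g-\hat f_n\|_\infty\le R_n\}$, where the centre $\hat f_n$ and the radius $R_n$ are functions of the observed path (they may depend on $M$ and all other parameters, but not on $f$). **Theorem.** Fix $0<\gamma<\tfrac12$, $0<s_{\min}<s_{\max}$ and $M>0$. Set $$r_n(s)=(n/\log n)^{-s/(2s+1)},\qquad \mathcal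 F=\bigcup_{s\in(s_{\min},s_{\max})}C^s_1(M).$$ No sequence of confidence bands $C_n$ with radii $R_n$ satisfies both 1. $\limsup_n\mathbb P_f(f\notin C_n)\le\gamma$ for every $f\in\mathcal F$; and 2. $R_n=O_p(r_n(s))$ under $\mathbb P_f$, for every $f\in C^s_1(M)$ and every $s\in(s_{\min},s_{\max})$. -/

import Mathlib

open Set Filter Topology MeasureTheory ProbabilityTheory
open scoped ENNReal NNReal

noncomputable section

namespace WaveletBand

/-! ### Wavelets on the real line -/

/-- The dilated and translated function `g_{j,k}(x) = 2^{j/2} g(2^j x - k)`. -/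
def scaled (g : ℝ → ℝ) (j k : ℤ) : ℝ → ℝ :=
  fun x => (2 : ℝ) ^ ((j : ℝ) / 2) * g ((2 : ℝ) ^ j * x - k)

/-- The closed linear span in `L²(ℝ)` of the functions `g_{j,k}`, `k ∈ ℤ`. -/
def scaleSpace (g : ℝ → ℝ) (j : ℤ) : Submodule ℝ (Lp ℝ 2 (volume : Measure ℝ)) :=
  (Submodule.span ℝ {u : Lp ℝ 2 (volume : Measure ℝ) | ∃ k : ℤ, u =ᵐ[volume] scaled g j k}).topologicalClosure

/-- `φ` and `ψ` are the scaling function and the wavelet of an orthonormal multiresolution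
analysis of `L²(ℝ)`. The approximation spaces are `V_j = scaleSpace φ j`; the integer translates
of `ψ` are an orthonormal basis of the orthogonal complement of `V_0` in `V_1`. -/
structure IsOrthonormalMRA (φ ψ : ℝ → ℝ) : Prop where
  memLp_scaling : MemLp φ 2 volume
  memLp_wavelet : MemLp ψ 2 volume
  orthonormal_scaling : ∀ k l : ℤ,
    ∫ x, scaled φ 0 k x * scaled φ 0 l x = if k = l then 1 else 0
  nested : ∀ j : ℤ, scaleSpace φ j ≤ scaleSpace φ (j + 1)
  dense_union : (⨆ j : ℤ, scaleSpace φ j).topologicalClosure = ⊤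
  trivial_inter : ⨅ j : ℤ, scaleSpace φ j = ⊥
  orthonormal_wavelet : ∀ k l : ℤ,
    ∫ x, scaled ψ 0 k x * scaled ψ 0 l x = if k = l then 1 else 0
  wavelet_span : scaleSpace ψ 0 = scaleSpace φ 1 ⊓ (scaleSpace φ 0)ᗮ

/-- Support in `[1 - K, K]`, `N` vanishing moments, and a twice continuously differentiable
scaling function. -/
structure IsRegularWavelet (φ ψ : ℝ → ℝ) (K N : ℕ) : Prop where
  support_scaling : Function.support φ ⊆ Icc (1 - (K : ℝ)) K
  support_wavelet : Function.support ψ ⊆ Icc (1 - (K : ℝ)) K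
  vanishing_moments : ∀ i < N, ∫ x, x ^ i * ψ x = 0
  contDiff_scaling : ContDiff ℝ 2 φ

/-! ### Wavelets on the unit interval -/

/-- A wavelet basis of `L²([0,1])` generated by `φ` and `ψ`: basis functions `scal k`
(`0 ≤ k < 2^j₀`, written `φ_{j₀,k}`) and `wav j k` (`j > j₀`, `0 ≤ k < 2^j`, written `ψ_{j,k}`),
which form an orthonormal basis, are continuous on `[0,1]`, and for `k ∈ [N, 2^j - N)` are the
scalings of `φ` and `ψ`. Only the values on `[0,1]` of the basis functions matter. The remaining
boundary functions are not restricted further, so that the boundary-corrected bases of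
Cohen, Daubechies and Vial are included, whatever choices are made in constructing them. -/
structure IntervalWaveletBasis (φ ψ : ℝ → ℝ) (N : ℕ) where
  /-- the lowest resolution level -/
  j₀ : ℕ
  /-- the scaling functions at level `j₀` -/
  scal : ℕ → ℝ → ℝ
  /-- the wavelets at the levels above `j₀` -/
  wav : ℕ → ℕ → ℝ → ℝ
  j₀_pos : 0 < j₀
  scal_interior : ∀ k, N ≤ k → k + N < 2 ^ j₀ → ∀ x ∈ Icc (0 : ℝ) 1,
    scal k x = scaled φ j₀ k x
  wav_interior : ∀ j k, j₀ < j → N ≤ k → k + N < 2 ^ j → ∀ x ∈ Icc (0 : ℝ) 1,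
    wav j k x = scaled ψ j k x
  scal_continuous : ∀ k < 2 ^ j₀, ContinuousOn (scal k) (Icc 0 1)
  wav_continuous : ∀ j k, j₀ < j → k < 2 ^ j → ContinuousOn (wav j k) (Icc 0 1)
  scal_scal : ∀ k < 2 ^ j₀, ∀ l < 2 ^ j₀,
    ∫ x in (0 : ℝ)..1, scal k x * scal l x = if k = l then 1 else 0
  scal_wav : ∀ k < 2 ^ j₀, ∀ j l, j₀ < j → l < 2 ^ j →
    ∫ x in (0 : ℝ)..1, scal k x * wav j l x = 0
  wav_wav : ∀ i k, j₀ < i → k < 2 ^ i → ∀ j l, j₀ < j → l < 2 ^ j →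
    ∫ x in (0 : ℝ)..1, wav i k x * wav j l x = if i = j ∧ k = l then 1 else 0
  complete : ∀ f : ℝ → ℝ, MemLp f 2 (volume.restrict (Icc 0 1)) →
    (∀ k < 2 ^ j₀, ∫ x in (0 : ℝ)..1, f x * scal k x = 0) →
    (∀ j k, j₀ < j → k < 2 ^ j → ∫ x in (0 : ℝ)..1, f x * wav j k x = 0) →
    f =ᵐ[volume.restrict (Icc 0 1)] 0

namespace IntervalWaveletBasis

variable {φ ψ : ℝ → ℝ} {N : ℕ} (W : IntervalWaveletBasis φ ψ N)

/-- The scaling coefficient `α_k` of `f`. -/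
def scalCoeff (f : ℝ → ℝ) (k : ℕ) : ℝ := ∫ x in (0 : ℝ)..1, f x * W.scal k x

/-- The wavelet coefficient `β_{j,k}` of `f`. -/
def wavCoeff (f : ℝ → ℝ) (j k : ℕ) : ℝ := ∫ x in (0 : ℝ)..1, f x * W.wav j k x

/-- The `C^s` norm `max (sup_k |α_k|, sup_{j,k} 2^{j(s+1/2)} |β_{j,k}|)`, in `[0, ∞]`. -/
def holderNorm (s : ℝ) (f : ℝ → ℝ) : ℝ≥0∞ :=
  max (⨆ k ∈ Finset.range (2 ^ W.j₀), ENNReal.ofReal |W.scalCoeff f k|)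
    (⨆ j : ℕ, ⨆ _ : W.j₀ < j, ⨆ k ∈ Finset.range (2 ^ j),
      ENNReal.ofReal ((2 : ℝ) ^ ((j : ℝ) * (s + 1 / 2)) * |W.wavCoeff f j k|))

/-- The wavelet series `f_{i,j}` of `f` from level `i ≥ j₀` to level `j`; for `i = j₀` it contains
the scaling functions, and the wavelets of the levels `j₀ + 1, …, j`. -/
def truncation (i j : ℕ) (f : ℝ → ℝ) : ℝ → ℝ := fun x =>
  (if i = W.j₀ then ∑ k ∈ Finset.range (2 ^ W.j₀), W.scalCoeff f k * W.scal k x else 0) +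
    ∑ l ∈ Finset.Icc (max i (W.j₀ + 1)) j, ∑ k ∈ Finset.range (2 ^ l),
      W.wavCoeff f l k * W.wav l k x

/-- The ball `C^s(M)`. Its elements are represented by continuous functions; only the values
on `[0,1]` matter. -/
def holderBall (s M : ℝ) : Set (ℝ → ℝ) :=
  {f | ContinuousOn f (Icc 0 1) ∧ W.holderNorm s f ≤ ENNReal.ofReal M}

/-- The class `C^s_1(M)` of weakly self-similar functions, with parameters `ε` and `(ρ_j)`:
those `f ∈ C^s(M)` with `‖f_{j, ρ_j j}‖_{C^s} ≥ ε M` for all `j ≥ j₀`. -/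
def weaklySelfSimilar (ε : ℝ) (ρ : ℕ → ℕ) (s M : ℝ) : Set (ℝ → ℝ) :=
  {f | f ∈ W.holderBall s M ∧
    ∀ j ≥ W.j₀, ENNReal.ofReal (ε * M) ≤ W.holderNorm s (W.truncation j (ρ j * j) f)}

end IntervalWaveletBasis

/-! ### The white noise model and confidence bands -/

/-- The space of observed paths `(Y_t)_{t ∈ [0,1]}`, with the product σ-algebra (generated by the
coordinates `Y_t`). -/
abbrev PathSpace : Type := unitInterval → ℝ

/-- The law `P_f` of the observation `Y_t = ∫_0^t f(s) ds + n^{-1/2} B_t`, `t ∈ [0,1]`, for a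
process `B` on a probability space `(Ω, P)`. -/
def whiteNoiseLaw {Ω : Type*} [MeasurableSpace Ω] (P : Measure Ω) (B : ℝ≥0 → Ω → ℝ)
    (n : ℕ) (f : ℝ → ℝ) : Measure PathSpace :=
  P.map fun ω t => (∫ x in (0 : ℝ)..t, f x) + (√(n : ℝ))⁻¹ * B (unitInterval.toNNReal t) ω

/-- A band: a centre (an estimator of `f` on `[0,1]`) and a radius, both functions of the
observed path. Measurability is not required: probabilities of events about bands are outer
probabilities under `whiteNoiseLaw`, and agree with probabilities where the event is measurable. -/
structure Band where
  /-- the estimator at the centre of the band -/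
  center : PathSpace → ℝ → ℝ
  /-- the radius of the band -/
  radius : PathSpace → ℝ

/-- The set of continuous `f` on `[0,1]` with `‖f - center‖_∞ ≤ radius`. -/
def Band.toSet (C : Band) (y : PathSpace) : Set (ℝ → ℝ) :=
  {f | ContinuousOn f (Icc 0 1) ∧ ∀ x ∈ Icc (0 : ℝ) 1, |f x - C.center y x| ≤ C.radius y}

/-- `X_n = O_p(r_n)` under the laws `Q_n`. -/
def IsBigOInProbability {𝓨 : Type*} [MeasurableSpace 𝓨] (Q : ℕ → Measure 𝓨) (X : ℕ → 𝓨 → ℝ)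
    (r : ℕ → ℝ) : Prop :=
  ∀ δ : ℝ, 0 < δ → ∃ D : ℝ, 0 < D ∧ ∀ᶠ n in atTop,
    Q n {y | D * r n < |X n y|} ≤ ENNReal.ofReal δ

/-- The rate `r_n(s) = (n / log n)^{-s/(2s+1)}`. -/
def rate (s : ℝ) (n : ℕ) : ℝ := ((n : ℝ) / Real.log n) ^ (-(s / (2 * s + 1)))

end WaveletBand

end

/-! Suppose that a sequence of bands has both properties. A function of the class is then built as a
limit of stages, and the bands miss it with probability at least 1/2 at infinitely many `n`; since
`γ < 1/2`, this contradicts coverage.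

Each stage is a self-similar function `f` of smoothness `s`, with coefficients of full size `M
2^{-l(s+1/2)}` in the even levels of its tail. Applied to this fixed `f`, the assumptions give, for
all large `n`, an event `A` of probability at least `1 - γ - 2δ` on which the band contains `f` and
has radius at most `D r_n(s)`. Now one wavelet is added to `f` in an odd level `c`, with a
coefficient of the slightly smaller smoothness `t = s - E r/(2c)`, where `ε = 2^{-E}`. With `n` of
the order `c 2^{c(2t+1)}`, a second moment bound over some `2^c/(4K)` possible locations
(`pi_gaussianReal_le_average`, carried over to paths by `whiteNoiseLaw_le_average`) shows that for
some location `A` loses at most `δ` of its probability (`exists_hidden_wavelet`). The added wavelet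
has height of order `2^{-ct}`, whereas `r_n(s)` is at most a constant times `2^{-ct} q^r` with `q <
1` (`rpow_gap_eq`, `exists_scales`). A large `r` therefore beats the unknown `D`, and on `A` the
band misses the new function. Changes in the levels from `βc` on are too small to be detected or to
matter uniformly, so the same `n` also works for every later stage and for the limit
(`exists_location_of_good_event`).

Weak self-similarity survives because its windows are long (`isStage_nextStage`). The old even
levels up to `a = c/r` are still within the factor `ε` of the size required for the new smoothness.
Windows starting between `a` and `c` reach the new wavelet if `ρ_j ≥ r`, and those starting between
`c` and `βc` reach the new tail if `ρ_j ≥ β`. This is where `ρ_j → ∞` enters: it allows `r` to be as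
large as `D` demands. The smoothnesses of the stages decrease, their lower bounds increase, and the
supremum of the lower bounds is the smoothness of the limit (`exists_limit`). -/

namespace WaveletBand

/-! ### Shifts of finite-dimensional Gaussian measures -/

section FiniteDimensional

variable {ι : Type*} [Fintype ι]

/-- The density of the shift by `m` of a centred Gaussian product measure with variances `v`. -/
noncomputable def shiftDensity (v : ι → ℝ≥0) (m x : ι → ℝ) : ℝ :=
  ∏ i, Real.exp ((m i * x i - m i ^ 2 / 2) / v i)

theorem gaussianReal_eq_withDensity {v : ℝ≥0} (hv : v ≠ 0) (m : ℝ) :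
    gaussianReal m v = (gaussianReal 0 v).withDensity
      fun x => ENNReal.ofReal (Real.exp ((m * x - m ^ 2 / 2) / v)) := by
  rw [gaussianReal_of_var_ne_zero _ hv, gaussianReal_of_var_ne_zero _ hv,
    ← withDensity_mul _ (measurable_gaussianPDF 0 v) (by fun_prop)]
  congr 1
  ext x
  have hv' : (v : ℝ) ≠ 0 := by exact_mod_cast hv
  simp only [gaussianPDF, gaussianPDFReal, Pi.mul_apply]
  rw [← ENNReal.ofReal_mul (by positivity), mul_assoc (√_)⁻¹, ← Real.exp_add]
  congr 3
  field_simp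
  ring

theorem integral_exp_gaussianReal (v : ℝ≥0) (t : ℝ) :
    ∫ x, Real.exp (t * x) ∂gaussianReal 0 v = Real.exp (v * t ^ 2 / 2) := by
  have := mgf_gaussianReal (p := gaussianReal 0 v) (X := id) Measure.map_id t
  simpa [mgf] using this

theorem integrable_exp_shift (v : ℝ≥0) (a c : ℝ) :
    Integrable (fun x => Real.exp ((a * x - c) / v)) (gaussianReal 0 v) := by
  have h : (fun x => Real.exp ((a * x - c) / v))
      = fun x => Real.exp (-c / v) * Real.exp ((a / v) * x) := by
    ext x
    rw [← Real.exp_add]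
    congr 1
    ring
  rw [h]
  exact (integrable_exp_mul_gaussianReal _).const_mul _

theorem integral_exp_shift {v : ℝ≥0} (hv : v ≠ 0) (a b : ℝ) :
    ∫ x, Real.exp ((a * x - a ^ 2 / 2) / v) * Real.exp ((b * x - b ^ 2 / 2) / v) ∂gaussianReal 0 v
      = Real.exp (a * b / v) := by
  have hv' : (v : ℝ) ≠ 0 := by exact_mod_cast hv
  have h : (fun x => Real.exp ((a * x - a ^ 2 / 2) / v) * Real.exp ((b * x - b ^ 2 / 2) / v))
      = fun x => Real.exp (-(a ^ 2 + b ^ 2) / 2 / v) * Real.exp (((a + b) / v) * x) := by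
    ext x
    rw [← Real.exp_add, ← Real.exp_add]
    congr 1
    ring
  rw [h, integral_const_mul, integral_exp_gaussianReal, ← Real.exp_add]
  congr 1
  field_simp
  ring

theorem measurable_shiftDensity (v : ι → ℝ≥0) (m : ι → ℝ) : Measurable (shiftDensity v m) := by
  unfold shiftDensity
  fun_prop

theorem shiftDensity_nonneg (v : ι → ℝ≥0) (m x : ι → ℝ) : 0 ≤ shiftDensity v m x :=
  Finset.prod_nonneg fun _ _ => (Real.exp_pos _).le

theorem integrable_shiftDensity (v : ι → ℝ≥0) (m : ι → ℝ) :
    Integrable (shiftDensity v m) (Measure.pi fun i => gaussianReal 0 (v i)) :=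
  Integrable.fintype_prod (f := fun i x => Real.exp ((m i * x - m i ^ 2 / 2) / v i))
    fun _ => integrable_exp_shift _ _ _

theorem shiftDensity_mul (v : ι → ℝ≥0) (m m' x : ι → ℝ) :
    shiftDensity v m x * shiftDensity v m' x
      = ∏ i, (Real.exp ((m i * x i - m i ^ 2 / 2) / v i)
        * Real.exp ((m' i * x i - m' i ^ 2 / 2) / v i)) := by
  rw [shiftDensity, shiftDensity, Finset.prod_mul_distrib]

theorem integrable_shiftDensity_mul (v : ι → ℝ≥0) (m m' : ι → ℝ) :
    Integrable (fun x => shiftDensity v m x * shiftDensity v m' x)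
      (Measure.pi fun i => gaussianReal 0 (v i)) := by
  simp_rw [shiftDensity_mul]
  refine Integrable.fintype_prod (f := fun i x => Real.exp ((m i * x - m i ^ 2 / 2) / v i)
        * Real.exp ((m' i * x - m' i ^ 2 / 2) / v i)) fun i => ?_
  convert integrable_exp_shift (v i) (m i + m' i) (m i ^ 2 / 2 + m' i ^ 2 / 2) using 2 with x
  rw [← Real.exp_add]
  congr 1
  ring

/-- Completing the square in each coordinate leaves only the weighted inner product of the shifts.
Orthogonal shifts thus have uncorrelated likelihood ratios, which is what the second moment method
needs. -/
theorem integral_shiftDensity_mul {v : ι → ℝ≥0} (hv : ∀ i, v i ≠ 0) (m m' : ι → ℝ) :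
    ∫ x, shiftDensity v m x * shiftDensity v m' x ∂(Measure.pi fun i => gaussianReal 0 (v i))
      = Real.exp (∑ i, m i * m' i / v i) := by
  simp_rw [shiftDensity_mul]
  rw [integral_fintype_prod_eq_prod (f := fun i x => Real.exp ((m i * x - m i ^ 2 / 2) / v i)
        * Real.exp ((m' i * x - m' i ^ 2 / 2) / v i)), Real.exp_sum]
  exact Finset.prod_congr rfl fun i _ => integral_exp_shift (hv i) _ _

theorem pi_gaussianReal_eq_withDensity {v : ι → ℝ≥0} (hv : ∀ i, v i ≠ 0) (m : ι → ℝ) :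
    (Measure.pi fun i => gaussianReal (m i) (v i))
      = (Measure.pi fun i => gaussianReal 0 (v i)).withDensity
          fun x => ENNReal.ofReal (shiftDensity v m x) := by
  classical
  refine Measure.pi_eq fun s hs => ?_
  have hS : MeasurableSet (univ.pi s) := MeasurableSet.univ_pi hs
  rw [withDensity_apply _ hS, ← ofReal_integral_eq_lintegral_ofReal
    (integrable_shiftDensity v m).integrableOn (ae_of_all _ (shiftDensity_nonneg v m)),
    ← integral_indicator hS]
  have h : (univ.pi s).indicator (shiftDensity v m)
      = fun x => ∏ i, (s i).indicator (fun y => Real.exp ((m i * y - m i ^ 2 / 2) / v i)) (x i) := by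
    ext x
    by_cases hx : x ∈ univ.pi s
    · rw [indicator_of_mem hx]
      exact Finset.prod_congr rfl fun i _ => by rw [indicator_of_mem (hx i trivial)]
    · rw [indicator_of_notMem hx]
      simp only [Set.mem_pi, mem_univ, forall_const, not_forall] at hx
      obtain ⟨i, hi⟩ := hx
      exact (Finset.prod_eq_zero (Finset.mem_univ i) (indicator_of_notMem hi _)).symm
  rw [h, integral_fintype_prod_eq_prod
    (f := fun i => (s i).indicator (fun y => Real.exp ((m i * y - m i ^ 2 / 2) / v i))),
    ENNReal.ofReal_prod_of_nonneg]
  · refine Finset.prod_congr rfl fun i _ => ?_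
    rw [gaussianReal_eq_withDensity (hv i) (m i), withDensity_apply _ (hs i), integral_indicator (hs i),
      ofReal_integral_eq_lintegral_ofReal (integrable_exp_shift _ _ _).integrableOn
        (ae_of_all _ fun x => (Real.exp_pos _).le)]
  · exact fun i _ => integral_nonneg fun x => indicator_nonneg (fun _ _ => (Real.exp_pos _).le) _

theorem pi_gaussianReal_shift {v : ι → ℝ≥0} (m : ι → ℝ) :
    (Measure.pi fun i => gaussianReal 0 (v i)).map (fun x => x + m)
      = Measure.pi fun i => gaussianReal (m i) (v i) := by
  have hm : ∀ i, Measure.map (fun x => x + m i) (gaussianReal 0 (v i))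
      = gaussianReal (m i) (v i) := fun i => by
    rw [gaussianReal_map_add_const, zero_add]
  have : ∀ i, SigmaFinite (Measure.map (fun x => x + m i) (gaussianReal 0 (v i))) := fun i => by
    rw [hm]; infer_instance
  have h := Measure.pi_map_pi (μ := fun i => gaussianReal 0 (v i)) (f := fun i x => x + m i)
    (fun i => by fun_prop)
  simp_rw [hm] at h
  exact h

theorem real_shift_eq_setIntegral {v : ι → ℝ≥0} (hv : ∀ i, v i ≠ 0) (m : ι → ℝ)
    {S : Set (ι → ℝ)} (hS : MeasurableSet S) :
    (Measure.pi fun i => gaussianReal 0 (v i)).real {x | x + m ∈ S}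
      = ∫ x in S, shiftDensity v m x ∂(Measure.pi fun i => gaussianReal 0 (v i)) := by
  rw [integral_eq_lintegral_of_nonneg_ae (ae_of_all _ (shiftDensity_nonneg v m))
    (measurable_shiftDensity v m).aestronglyMeasurable, ← withDensity_apply _ hS,
    ← pi_gaussianReal_eq_withDensity hv, ← pi_gaussianReal_shift m,
    Measure.map_apply (by fun_prop) hS]
  rfl

/-- The second moment method: a Gaussian product measure is close to the uniform mixture of its
shifts by vectors with disjoint supports. -/
theorem pi_gaussianReal_le_average {κ : Type*} [Fintype κ] [Nonempty κ]
    {v : ι → ℝ≥0} (hv : ∀ i, v i ≠ 0) (m : κ → ι → ℝ) {τ : ℝ}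
    (hτ : ∀ k, ∑ i, m k i ^ 2 / v i ≤ τ) (hm : ∀ k l, k ≠ l → ∀ i, m k i * m l i = 0)
    {S : Set (ι → ℝ)} (hS : MeasurableSet S) :
    (Measure.pi fun i => gaussianReal 0 (v i)).real S
      ≤ (Fintype.card κ : ℝ)⁻¹ *
          ∑ k, (Measure.pi fun i => gaussianReal 0 (v i)).real {x | x + m k ∈ S}
        + √((Real.exp τ - 1) / Fintype.card κ) := by
  classical
  set ν := Measure.pi fun i => gaussianReal 0 (v i) with hν
  set p : ℝ := (Fintype.card κ : ℝ) with hp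
  have hp0 : 0 < p := by rw [hp]; exact_mod_cast Fintype.card_pos
  -- The likelihood ratio of the mixture. Its mean is 1, so its variance controls the `L¹` distance
  -- to 1.
  set L : (ι → ℝ) → ℝ := fun x => p⁻¹ * ∑ k, shiftDensity v (m k) x with hL
  have hLint : Integrable L ν :=
    (integrable_finsetSum _ fun k _ => integrable_shiftDensity v (m k)).const_mul _
  have hone : ∀ k, ∫ x, shiftDensity v (m k) x ∂ν = 1 := fun k => by
    have := real_shift_eq_setIntegral hv (m k) MeasurableSet.univ
    simpa using this.symm
  have hL1 : ∫ x, L x ∂ν = 1 := by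
    rw [hL, integral_const_mul, integral_finsetSum _ fun k _ => integrable_shiftDensity v (m k)]
    rw [Finset.sum_congr rfl fun k _ => hone k, Finset.sum_const, Finset.card_univ, nsmul_eq_mul,
      mul_one, inv_mul_cancel₀ hp0.ne']
  have hLL : ∀ x, L x ^ 2 = p⁻¹ ^ 2 * ∑ k, ∑ l, shiftDensity v (m k) x * shiftDensity v (m l) x := by
    intro x
    rw [hL]
    simp only
    rw [mul_pow, sq (∑ k, _), Finset.sum_mul_sum]
  have hL2int : Integrable (fun x => L x ^ 2) ν := by
    simp_rw [hLL]
    exact (integrable_finsetSum _ fun k _ => integrable_finsetSum _ fun l _ =>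
      integrable_shiftDensity_mul v (m k) (m l)).const_mul _
  have hL2 : ∫ x, L x ^ 2 ∂ν ≤ 1 + (Real.exp τ - 1) / p := by
    simp_rw [hLL]
    rw [integral_const_mul, integral_finsetSum _ fun k _ => integrable_finsetSum _ fun l _ =>
      integrable_shiftDensity_mul v (m k) (m l)]
    have h1 : ∀ k, ∫ x, ∑ l, shiftDensity v (m k) x * shiftDensity v (m l) x ∂ν
        ≤ p + (Real.exp τ - 1) := by
      intro k
      rw [integral_finsetSum _ fun l _ => integrable_shiftDensity_mul v (m k) (m l)]
      rw [Finset.sum_congr rfl fun l _ => integral_shiftDensity_mul hv (m k) (m l)]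
      -- Off-diagonal pairs contribute exactly 1 because the supports are disjoint; only the `p`
      -- diagonal pairs contribute up to `e^τ`.
      have h2 : ∀ l, Real.exp (∑ i, m k i * m l i / v i)
          ≤ 1 + if l = k then Real.exp τ - 1 else 0 := by
        intro l
        split_ifs with h
        · subst h
          simp_rw [← sq]
          simpa using hτ l
        · simp [hm k l (Ne.symm h)]
      refine (Finset.sum_le_sum fun l _ => h2 l).trans ?_
      simp [Finset.sum_add_distrib, hp]
    calc p⁻¹ ^ 2 * ∑ k, ∫ x, ∑ l, shiftDensity v (m k) x * shiftDensity v (m l) x ∂ν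
        ≤ p⁻¹ ^ 2 * ∑ _k : κ, (p + (Real.exp τ - 1)) := by
          gcongr with k _
          exact h1 k
      _ = 1 + (Real.exp τ - 1) / p := by
          simp [← hp]
          field_simp
  have hvar : ∫ x, (1 - L x) ^ 2 ∂ν ≤ (Real.exp τ - 1) / p := by
    have h3 : ∀ x, (1 - L x) ^ 2 = 1 - 2 * L x + L x ^ 2 := fun x => by ring
    simp_rw [h3]
    rw [integral_add (f := fun x => 1 - 2 * L x)
      ((integrable_const _).sub (hLint.const_mul _)) hL2int, integral_sub (integrable_const _) (hLint.const_mul _), integral_const_mul, hL1]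
    simp
    linarith
  have habs : ∫ x, |1 - L x| ∂ν ≤ √((Real.exp τ - 1) / p) := by
    have hmem : MemLp (fun x => |1 - L x|) 2 ν := by
      have hms : AEStronglyMeasurable (fun x => 1 - L x) ν :=
        ((integrable_const _).sub hLint).aestronglyMeasurable
      refine MemLp.abs ((memLp_two_iff_integrable_sq hms).2 ?_)
      have h3 : ∀ x, (1 - L x) ^ 2 = 1 - 2 * L x + L x ^ 2 := fun x => by ring
      simp_rw [h3]
      exact ((integrable_const _).sub (hLint.const_mul _)).add hL2int
    refine Real.le_sqrt_of_sq_le (le_trans ?_ hvar)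
    -- Jensen's inequality, in the form that the variance of `|1 - L|` is non-negative.
    have := variance_nonneg (fun x => |1 - L x|) ν
    rw [variance_eq_sub hmem] at this
    simp only [Pi.pow_apply, sq_abs] at this
    linarith
  have hdiff : ν.real S - p⁻¹ * ∑ k, ν.real {x | x + m k ∈ S} = ∫ x in S, (1 - L x) ∂ν := by
    rw [integral_sub (integrable_const _) hLint.integrableOn, hL, integral_const_mul,
      integral_finsetSum _ fun k _ => (integrable_shiftDensity v (m k)).integrableOn]
    simp_rw [hν, real_shift_eq_setIntegral hv _ hS]
    simp
  have hle : ∫ x in S, (1 - L x) ∂ν ≤ ∫ x, |1 - L x| ∂ν := by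
    have hi : Integrable (fun x => 1 - L x) ν := (integrable_const _).sub hLint
    calc ∫ x in S, (1 - L x) ∂ν ≤ ∫ x in S, |1 - L x| ∂ν :=
          integral_mono hi.integrableOn hi.abs.integrableOn fun x => le_abs_self _
      _ ≤ ∫ x, |1 - L x| ∂ν :=
          setIntegral_le_integral hi.abs (ae_of_all _ fun x => abs_nonneg _)
  linarith

end FiniteDimensional

/-! ### Shifts of Brownian motion -/

section Brownian

variable {Ω : Type*} [MeasurableSpace Ω] {P : Measure Ω} {B : ℝ≥0 → Ω → ℝ}

/-- The path of the noise `n^{-1/2} B` on the unit interval. -/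
noncomputable def noisePath (B : ℝ≥0 → Ω → ℝ) (n : ℕ) (ω : Ω) : PathSpace :=
  fun t => (√(n : ℝ))⁻¹ * B (unitInterval.toNNReal t) ω

/-- The path with given increments between the points of a partition. -/
noncomputable def pathOfIncrements {d : ℕ} (t : Fin (d + 1) → unitInterval) (x : Fin d → ℝ) :
    PathSpace :=
  fun u => ∑ i with t i.succ ≤ u, x i

/-- The increments of a path along a partition. -/
def pathIncrements {d : ℕ} (t : Fin (d + 1) → unitInterval) (y : PathSpace) : Fin d → ℝ :=
  fun i => y (t i.succ) - y (t i.castSucc)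

theorem pathOfIncrements_pathIncrements {d : ℕ} {t : Fin (d + 1) → unitInterval}
    (ht : StrictMono t) (y : PathSpace) (j : Fin (d + 1)) :
    pathOfIncrements t (pathIncrements t y) (t j) = y (t j) - y (t 0) := by
  simp only [pathOfIncrements, pathIncrements, ht.le_iff_le]
  induction j using Fin.induction with
  | zero => simp
  | succ j ih =>
    have h : (Finset.univ.filter fun i : Fin d => i.succ ≤ j.succ)
        = insert j (Finset.univ.filter fun i : Fin d => i.succ ≤ j.castSucc) := by
      ext i
      simp only [Finset.mem_filter, Finset.mem_univ, true_and, Finset.mem_insert, Fin.le_def,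
        Fin.val_succ, Fin.val_castSucc, Fin.ext_iff]
      omega
    have hj : j ∉ Finset.univ.filter fun i : Fin d => i.succ ≤ j.castSucc := by
      simp [Fin.le_def]
    rw [h, Finset.sum_insert hj, ih]
    ring

theorem pathIncrements_add {d : ℕ} (t : Fin (d + 1) → unitInterval) (y z : PathSpace) :
    pathIncrements t (y + z) = pathIncrements t y + pathIncrements t z := by
  ext i
  simp only [pathIncrements, Pi.add_apply]
  ring

theorem measurable_pathOfIncrements {d : ℕ} (t : Fin (d + 1) → unitInterval) :
    Measurable (pathOfIncrements t) := by
  unfold pathOfIncrements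
  fun_prop

theorem measurable_noisePath (hBmeas : ∀ t, Measurable (B t)) (n : ℕ) :
    Measurable (noisePath B n) :=
  measurable_pi_lambda _ fun _ => (hBmeas _).const_mul _

theorem map_pathIncrements_noisePath (hB : IsPreBrownianReal B P) (n : ℕ) {d : ℕ}
    {t : Fin (d + 1) → unitInterval} (ht : StrictMono t) :
    P.map (fun ω => pathIncrements t (noisePath B n ω))
      = Measure.pi fun i => gaussianReal 0
          (((t i.succ : ℝ) - t i.castSucc).toNNReal / n) := by
  have hprob : IsProbabilityMeasure P := hB.isGaussianProcess.isProbabilityMeasure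
  have hmono : Monotone fun i => unitInterval.toNNReal (t i) := fun i j hij => by
    have : (t i : ℝ) ≤ t j := ht.monotone hij
    exact_mod_cast this
  have hind := (hB.hasIndepIncrements d _ hmono).comp (fun _ x => (√(n : ℝ))⁻¹ * x)
    (fun _ => by fun_prop)
  have hcomp : ∀ i : Fin d, (fun ω => pathIncrements t (noisePath B n ω) i)
      = (fun x => (√(n : ℝ))⁻¹ * x) ∘ fun ω => B (unitInterval.toNNReal (t i.succ)) ω
          - B (unitInterval.toNNReal (t i.castSucc)) ω := fun i => by
    ext ω
    simp only [pathIncrements, noisePath, Function.comp]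
    ring
  have hlaw : ∀ i : Fin d, HasLaw (fun ω => pathIncrements t (noisePath B n ω) i)
      (gaussianReal 0 (((t i.succ : ℝ) - t i.castSucc).toNNReal / n)) P := by
    intro i
    rw [hcomp]
    have h := gaussianReal_const_mul (hB.hasLaw_sub (unitInterval.toNNReal (t i.succ))
      (unitInterval.toNNReal (t i.castSucc))) (√(n : ℝ))⁻¹
    have hle : (t i.castSucc : ℝ) ≤ t i.succ := ht.monotone (Fin.castSucc_lt_succ).le
    convert h using 2
    · simp
    · simp
    · rw [← NNReal.coe_inj]
      simp only [NNReal.coe_div, NNReal.coe_natCast, NNReal.coe_mul, coe_nndist, NNReal.coe_mk,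
        Real.dist_eq]
      rw [Real.coe_toNNReal _ (sub_nonneg.2 hle), inv_pow, Real.sq_sqrt (Nat.cast_nonneg n)]
      have : |((unitInterval.toNNReal (t i.succ) : ℝ≥0) : ℝ)
          - (unitInterval.toNNReal (t i.castSucc) : ℝ≥0)| = (t i.succ : ℝ) - t i.castSucc :=
        abs_of_nonneg (sub_nonneg.2 hle)
      change _ = (n : ℝ)⁻¹ * |((unitInterval.toNNReal (t i.succ) : ℝ≥0) : ℝ)
          - (unitInterval.toNNReal (t i.castSucc) : ℝ≥0)|
      rw [this]
      ring
  have h := (iIndepFun_iff_map_fun_eq_pi_map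
    (f := fun (i : Fin d) ω => pathIncrements t (noisePath B n ω) i)
    fun i => (hlaw i).aemeasurable).1 (by rw [funext hcomp]; exact hind)
  simp_rw [(hlaw _).map_eq] at h
  exact h

/-- An enumeration of a finite set of times that contains `0`. -/
theorem exists_partition (T : Finset unitInterval) (hT : (0 : unitInterval) ∈ T) :
    ∃ (d : ℕ) (t : Fin (d + 1) → unitInterval), StrictMono t ∧ t 0 = 0 ∧
      ∀ u, u ∈ T ↔ ∃ j, t j = u := by
  obtain ⟨d, hd⟩ : ∃ d, T.card = d + 1 :=
    ⟨T.card - 1, (Nat.succ_pred_eq_of_pos (Finset.card_pos.2 ⟨0, hT⟩)).symm⟩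
  have hrange : ∀ u, u ∈ T ↔ ∃ j, T.orderEmbOfFin hd j = u := fun u => by
    rw [← Finset.mem_coe, ← Finset.range_orderEmbOfFin T hd, mem_range]
  refine ⟨d, T.orderEmbOfFin hd, (T.orderEmbOfFin hd).strictMono, ?_, hrange⟩
  obtain ⟨j, hj⟩ := (hrange 0).1 hT
  refine le_antisymm ?_ unitInterval.nonneg'
  rw [← hj]
  exact (T.orderEmbOfFin hd).monotone (Fin.zero_le j)

/-- A Brownian path restricted to finitely many times is close to a mixture of shifted paths. -/
theorem noisePath_cylinder_le_average (hB : IsPreBrownianReal B P)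
    (hBmeas : ∀ t, Measurable (B t)) {n : ℕ} (hn : n ≠ 0) {κ : Type*} [Fintype κ] [Nonempty κ]
    (H : κ → PathSpace) (hH0 : ∀ k, H k 0 = 0) {τ : ℝ}
    (hτ : ∀ k (d : ℕ) (t : Fin (d + 1) → unitInterval), StrictMono t →
      n * ∑ i : Fin d, pathIncrements t (H k) i ^ 2 / ((t i.succ : ℝ) - t i.castSucc) ≤ τ)
    (G : Finset unitInterval)
    (hG : ∀ k l, k ≠ l → ∀ x y : unitInterval, x < y → (∀ g ∈ G, g ≤ x ∨ y ≤ g) →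
      (H k y - H k x) * (H l y - H l x) = 0)
    {A : Set PathSpace} (hA : A ∈ measurableCylinders fun _ : unitInterval => ℝ) :
    P.real {ω | noisePath B n ω ∈ A}
      ≤ (Fintype.card κ : ℝ)⁻¹ * ∑ k, P.real {ω | noisePath B n ω + H k ∈ A}
        + √((Real.exp τ - 1) / Fintype.card κ) := by
  classical
  have hprob : IsProbabilityMeasure P := hB.isGaussianProcess.isProbabilityMeasure
  obtain ⟨T₀, S, hS, rfl⟩ := (mem_measurableCylinders A).1 hA
  -- The times in `T₀` make the event a function of the increments, those in `G` separate the
  -- supports of the shifts, and 0 anchors the path.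
  obtain ⟨d, t, ht, ht0, hT⟩ := exists_partition (insert 0 (T₀ ∪ G)) (Finset.mem_insert_self _ _)
  set v : Fin d → ℝ≥0 := fun i => ((t i.succ : ℝ) - t i.castSucc).toNNReal / n with hv
  have hlt : ∀ i : Fin d, (t i.castSucc : ℝ) < t i.succ := fun i => ht (Fin.castSucc_lt_succ)
  have hvreal : ∀ i, (v i : ℝ) = ((t i.succ : ℝ) - t i.castSucc) / n := fun i => by
    rw [hv]
    simp only [NNReal.coe_div, NNReal.coe_natCast]
    rw [Real.coe_toNNReal _ (sub_pos.2 (hlt i)).le]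
  have hnpos : (0 : ℝ) < n := by exact_mod_cast Nat.pos_of_ne_zero hn
  have hv0 : ∀ i, v i ≠ 0 := fun i => by
    have : (v i : ℝ) ≠ 0 := by
      rw [hvreal]; exact (div_pos (sub_pos.2 (hlt i)) hnpos).ne'
    exact_mod_cast this
  have hmap := map_pathIncrements_noisePath hB n ht
  set S' : Set (Fin d → ℝ) := {x | pathOfIncrements t x ∈ cylinder (α := fun _ => ℝ) T₀ S} with hS'
  have hS'm : MeasurableSet S' :=
    measurable_pathOfIncrements t (MeasurableSet.cylinder T₀ hS)
  have hmeas : Measurable fun ω => pathIncrements t (noisePath B n ω) := by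
    have := measurable_noisePath hBmeas n
    unfold pathIncrements
    fun_prop
  have hkey : ∀ h : PathSpace, h 0 = 0 → P.real {ω | noisePath B n ω + h ∈ cylinder (α := fun _ => ℝ) T₀ S}
      = (Measure.pi fun i => gaussianReal 0 (v i)).real {x | x + pathIncrements t h ∈ S'} := by
    intro h hh
    have hm : MeasurableSet {x : Fin d → ℝ | x + pathIncrements t h ∈ S'} :=
      (measurable_add_const _) hS'm
    rw [hv, ← hmap, measureReal_def, measureReal_def, Measure.map_apply hmeas hm]
    congr 1
    -- Increments determine the path only up to its value at 0, which vanishes almost surely.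
    refine measure_congr ?_
    filter_upwards [hB.eval_zero_ae_eq_zero] with ω hω
    have hz : (noisePath B n ω + h) 0 = 0 := by
      simp only [Pi.add_apply, noisePath, hh, add_zero]
      rw [show unitInterval.toNNReal 0 = 0 from rfl, hω, mul_zero]
    apply propext
    change _ ∈ cylinder (α := fun _ => ℝ) T₀ S ↔ pathOfIncrements t _ ∈ cylinder (α := fun _ => ℝ) T₀ S
    rw [← pathIncrements_add, mem_cylinder, mem_cylinder]
    have : T₀.restrict (pathOfIncrements t (pathIncrements t (noisePath B n ω + h)))
        = T₀.restrict (noisePath B n ω + h) := by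
      ext u
      obtain ⟨j, hj⟩ := (hT u).1 (by simp)
      simp only [Finset.restrict]
      rw [← hj, pathOfIncrements_pathIncrements ht, ht0, hz, sub_zero]
    rw [this]
  have h0 := hkey 0 rfl
  simp only [add_zero] at h0
  rw [h0]
  simp_rw [fun k => hkey (H k) (hH0 k)]
  have hz : pathIncrements t (0 : PathSpace) = 0 := by
    ext i; simp [pathIncrements]
  rw [hz]
  simp only [add_zero]
  refine pi_gaussianReal_le_average hv0 (fun k => pathIncrements t (H k)) (fun k => ?_)
    (fun k l hkl i => ?_) hS'm
  · refine le_trans (le_of_eq ?_) (hτ k d t ht)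
    rw [Finset.mul_sum]
    refine Finset.sum_congr rfl fun i _ => ?_
    rw [hvreal]
    have := (sub_pos.2 (hlt i)).ne'
    field_simp
  · refine hG k l hkl _ _ (ht Fin.castSucc_lt_succ) fun g hg => ?_
    obtain ⟨j, rfl⟩ := (hT g).1 (by simp [hg])
    rw [ht.le_iff_le, ht.le_iff_le, Fin.le_def, Fin.le_def]
    simp only [Fin.val_castSucc, Fin.val_succ]
    omega

/-- The cylinder bound does not depend on the partition, and cylinders are dense among measurable
sets for any finite measure. Approximation under the sum of all the laws involved makes one cylinder
serve for all of them. -/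
theorem noisePath_le_average (hB : IsPreBrownianReal B P)
    (hBmeas : ∀ t, Measurable (B t)) {n : ℕ} (hn : n ≠ 0) {κ : Type*} [Fintype κ] [Nonempty κ]
    (H : κ → PathSpace) (hH0 : ∀ k, H k 0 = 0) {τ : ℝ}
    (hτ : ∀ k (d : ℕ) (t : Fin (d + 1) → unitInterval), StrictMono t →
      n * ∑ i : Fin d, pathIncrements t (H k) i ^ 2 / ((t i.succ : ℝ) - t i.castSucc) ≤ τ)
    (G : Finset unitInterval)
    (hG : ∀ k l, k ≠ l → ∀ x y : unitInterval, x < y → (∀ g ∈ G, g ≤ x ∨ y ≤ g) →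
      (H k y - H k x) * (H l y - H l x) = 0)
    {A : Set PathSpace} (hA : MeasurableSet A) :
    P.real {ω | noisePath B n ω ∈ A}
      ≤ (Fintype.card κ : ℝ)⁻¹ * ∑ k, P.real {ω | noisePath B n ω + H k ∈ A}
        + √((Real.exp τ - 1) / Fintype.card κ) := by
  have hprob : IsProbabilityMeasure P := hB.isGaussianProcess.isProbabilityMeasure
  have hm0 := measurable_noisePath hBmeas n
  have hm : ∀ k, Measurable fun ω => noisePath B n ω + H k := fun k => hm0.add_const _
  refine le_of_forall_pos_le_add fun δ hδ => ?_
  set μ : Measure PathSpace :=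
    P.map (noisePath B n) + ∑ k, P.map (fun ω => noisePath B n ω + H k) with hμ
  have hfin : IsFiniteMeasure μ := by
    have : ∀ k, IsFiniteMeasure (P.map (fun ω => noisePath B n ω + H k)) := fun k => inferInstance
    infer_instance
  obtain ⟨A', hA', hAA'⟩ := (Measure.MeasureDense.of_generateFrom_isSetAlgebra_finite μ
    isSetAlgebra_measurableCylinders generateFrom_measurableCylinders.symm).approx A hA
    (measure_ne_top _ _) (δ / 2) (by positivity)
  have hclose : ∀ Z : Ω → PathSpace, Measurable Z → P.map Z ≤ μ →
      |P.real {ω | Z ω ∈ A} - P.real {ω | Z ω ∈ A'}| ≤ δ / 2 := by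
    intro Z hZ hle
    have hA'm := MeasurableSet.of_mem_measurableCylinders hA'
    have h1 : P.real {ω | Z ω ∈ A} = (P.map Z).real A :=
      (map_measureReal_apply hZ hA).symm
    have h2 : P.real {ω | Z ω ∈ A'} = (P.map Z).real A' :=
      (map_measureReal_apply hZ hA'm).symm
    rw [h1, h2]
    refine (abs_measureReal_sub_le_measureReal_symmDiff hA.nullMeasurableSet
      hA'm.nullMeasurableSet).trans ?_
    rw [measureReal_def]
    exact ENNReal.toReal_le_of_le_ofReal (by positivity) ((hle _).trans hAA'.le)
  have hle0 : P.map (noisePath B n) ≤ μ := Measure.le_add_right le_rfl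
  have hlek : ∀ k, P.map (fun ω => noisePath B n ω + H k) ≤ μ := fun k => by
    refine Measure.le_add_left fun s => ?_
    rw [Measure.finsetSum_apply]
    exact Finset.single_le_sum (f := fun k => P.map (fun ω => noisePath B n ω + H k) s)
      (fun _ _ => zero_le) (Finset.mem_univ k)
  have hc0 := abs_le.1 (hclose _ hm0 hle0)
  have hck := fun k => abs_le.1 (hclose _ (hm k) (hlek k))
  have hmain := noisePath_cylinder_le_average hB hBmeas hn H hH0 hτ G hG hA'
  have hp0 : (0 : ℝ) < Fintype.card κ := by exact_mod_cast Fintype.card_pos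
  have hsum : (Fintype.card κ : ℝ)⁻¹ * ∑ k, P.real {ω | noisePath B n ω + H k ∈ A'}
      ≤ (Fintype.card κ : ℝ)⁻¹ * ∑ k, P.real {ω | noisePath B n ω + H k ∈ A} + δ / 2 := by
    calc (Fintype.card κ : ℝ)⁻¹ * ∑ k, P.real {ω | noisePath B n ω + H k ∈ A'}
        ≤ (Fintype.card κ : ℝ)⁻¹ * ∑ k, (P.real {ω | noisePath B n ω + H k ∈ A} + δ / 2) := by
          gcongr with k _
          linarith [(hck k).1]
      _ = _ := by
          rw [Finset.sum_add_distrib, Finset.sum_const, Finset.card_univ, nsmul_eq_mul, mul_add,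
            inv_mul_cancel_left₀ hp0.ne']
  linarith [hc0.2]

end Brownian

/-! ### Comparison of white noise experiments -/

section WhiteNoise

variable {Ω : Type*} [MeasurableSpace Ω] {P : Measure Ω} {B : ℝ≥0 → Ω → ℝ}

theorem intervalIntegrable_of_continuousOn_Icc {h : ℝ → ℝ} (hh : ContinuousOn h (Icc 0 1))
    {x y : ℝ} (hx : x ∈ Icc (0 : ℝ) 1) (hy : y ∈ Icc (0 : ℝ) 1) :
    IntervalIntegrable h volume x y :=
  (hh.mono (uIcc_subset_Icc hx hy)).intervalIntegrable

/-- Cauchy–Schwarz, from the non-negativity of the integral of `(h - c)²` with `c` the mean of `h`.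
-/
theorem sq_intervalIntegral_le {h : ℝ → ℝ} (hh : ContinuousOn h (Icc 0 1))
    {x y : ℝ} (hx : x ∈ Icc (0 : ℝ) 1) (hy : y ∈ Icc (0 : ℝ) 1) (hxy : x < y) :
    (∫ u in x..y, h u) ^ 2 / (y - x) ≤ ∫ u in x..y, h u ^ 2 := by
  set c := (∫ u in x..y, h u) / (y - x) with hc
  have h1 := intervalIntegrable_of_continuousOn_Icc hh hx hy
  have hh2 : ContinuousOn (fun u => h u ^ 2) (Icc 0 1) := hh.pow 2
  have h2 := intervalIntegrable_of_continuousOn_Icc hh2 hx hy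
  have h0 : 0 ≤ ∫ u in x..y, (h u - c) ^ 2 :=
    intervalIntegral.integral_nonneg hxy.le fun u _ => sq_nonneg _
  have h3 : ∫ u in x..y, (h u - c) ^ 2
      = (∫ u in x..y, h u ^ 2) - 2 * c * (∫ u in x..y, h u) + c ^ 2 * (y - x) := by
    have : ∀ u, (h u - c) ^ 2 = h u ^ 2 - 2 * c * h u + c ^ 2 := fun u => by ring
    simp_rw [this]
    rw [intervalIntegral.integral_add (h2.sub (h1.const_mul _)) intervalIntegrable_const,
      intervalIntegral.integral_sub h2 (h1.const_mul _), intervalIntegral.integral_const_mul,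
      intervalIntegral.integral_const, smul_eq_mul]
    ring
  have hne : y - x ≠ 0 := (sub_pos.2 hxy).ne'
  have h4 : 2 * c * (∫ u in x..y, h u) - c ^ 2 * (y - x)
      = (∫ u in x..y, h u) ^ 2 / (y - x) := by
    rw [hc]; field_simp; ring
  linarith

/-- The path `t ↦ ∫_0^t h`. -/
noncomputable def primitivePath (h : ℝ → ℝ) : PathSpace := fun t => ∫ x in (0 : ℝ)..t, h x

theorem primitivePath_sub {h : ℝ → ℝ} (hh : ContinuousOn h (Icc 0 1)) (x y : unitInterval) :
    primitivePath h y - primitivePath h x = ∫ u in (x : ℝ)..y, h u :=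
  intervalIntegral.integral_interval_sub_left
    (intervalIntegrable_of_continuousOn_Icc hh (left_mem_Icc.2 zero_le_one) y.2)
    (intervalIntegrable_of_continuousOn_Icc hh (left_mem_Icc.2 zero_le_one) x.2)

/-- The energy seen by finitely many increments never exceeds the full `L²` energy, so the second
moment bound is uniform over partitions. -/
theorem sum_sq_pathIncrements_le {h : ℝ → ℝ} (hh : ContinuousOn h (Icc 0 1)) {d : ℕ}
    {t : Fin (d + 1) → unitInterval} (ht : StrictMono t) :
    ∑ i : Fin d, pathIncrements t (primitivePath h) i ^ 2 / ((t i.succ : ℝ) - t i.castSucc)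
      ≤ ∫ x in (0 : ℝ)..1, h x ^ 2 := by
  have hh2 : ContinuousOn (fun x => h x ^ 2) (Icc 0 1) := hh.pow 2
  have h0 : (0 : ℝ) ∈ Icc (0 : ℝ) 1 := left_mem_Icc.2 zero_le_one
  have h1 : (1 : ℝ) ∈ Icc (0 : ℝ) 1 := right_mem_Icc.2 zero_le_one
  calc _ ≤ ∑ i : Fin d, pathIncrements t (primitivePath fun x => h x ^ 2) i := by
        refine Finset.sum_le_sum fun i _ => ?_
        simp only [pathIncrements]
        rw [primitivePath_sub hh, primitivePath_sub hh2]
        exact sq_intervalIntegral_le hh (t i.castSucc).2 (t i.succ).2 (ht Fin.castSucc_lt_succ)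
    _ = pathOfIncrements t (pathIncrements t (primitivePath fun x => h x ^ 2)) (t (Fin.last d)) := by
        simp only [pathOfIncrements, ht.le_iff_le, Fin.le_last, Finset.filter_true]
    _ = ∫ u in (t 0 : ℝ)..t (Fin.last d), h u ^ 2 := by
        rw [pathOfIncrements_pathIncrements ht, primitivePath_sub hh2]
    _ ≤ ∫ x in (0 : ℝ)..1, h x ^ 2 :=
        intervalIntegral.integral_mono_interval (t 0).2.1 (ht.monotone (Fin.zero_le _)) (t _).2.2
          (ae_of_all _ fun x => sq_nonneg _) (intervalIntegrable_of_continuousOn_Icc hh2 h0 h1)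

theorem whiteNoiseLaw_eq (n : ℕ) (f : ℝ → ℝ) :
    whiteNoiseLaw P B n f = P.map fun ω => primitivePath f + noisePath B n ω := rfl

theorem isProbabilityMeasure_whiteNoiseLaw (hB : IsPreBrownianReal B P)
    (hBmeas : ∀ t, Measurable (B t)) (n : ℕ) (f : ℝ → ℝ) :
    IsProbabilityMeasure (whiteNoiseLaw P B n f) := by
  have : IsProbabilityMeasure P := hB.isGaussianProcess.isProbabilityMeasure
  rw [whiteNoiseLaw_eq]
  exact Measure.isProbabilityMeasure_map
    ((measurable_noisePath hBmeas n).const_add _).aemeasurable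

theorem whiteNoiseLaw_congr {f g : ℝ → ℝ} (h : ∀ x ∈ Icc (0 : ℝ) 1, f x = g x) (n : ℕ) :
    whiteNoiseLaw P B n f = whiteNoiseLaw P B n g := by
  have : primitivePath f = primitivePath g := by
    ext t
    refine intervalIntegral.integral_congr fun x hx => h x ?_
    exact uIcc_subset_Icc (left_mem_Icc.2 zero_le_one) t.2 hx
  rw [whiteNoiseLaw_eq, whiteNoiseLaw_eq, this]

/-- The white noise law with mean `f` is close to the mixture of the laws with means `f + h k`,
where any two of the functions `h k` have disjoint supports, up to a finite set of times. -/
theorem whiteNoiseLaw_le_average (hB : IsPreBrownianReal B P)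
    (hBmeas : ∀ t, Measurable (B t)) {n : ℕ} (hn : n ≠ 0) {κ : Type*} [Fintype κ] [Nonempty κ]
    {f : ℝ → ℝ} (hf : ContinuousOn f (Icc 0 1)) {h : κ → ℝ → ℝ}
    (hh : ∀ k, ContinuousOn (h k) (Icc 0 1)) {τ : ℝ}
    (hτ : ∀ k, n * ∫ x in (0 : ℝ)..1, h k x ^ 2 ≤ τ) (G : Finset unitInterval)
    (hG : ∀ k l, k ≠ l → ∀ x y : unitInterval, x < y → (∀ g ∈ G, g ≤ x ∨ y ≤ g) →
      (∫ u in (x : ℝ)..y, h k u) * (∫ u in (x : ℝ)..y, h l u) = 0)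
    {A : Set PathSpace} (hA : MeasurableSet A) :
    (whiteNoiseLaw P B n f).real A
      ≤ (Fintype.card κ : ℝ)⁻¹ * ∑ k, (whiteNoiseLaw P B n fun x => f x + h k x).real A
        + √((Real.exp τ - 1) / Fintype.card κ) := by
  have hadd : ∀ k, primitivePath (fun x => f x + h k x)
      = primitivePath f + primitivePath (h k) := fun k => by
    ext t
    have h0 : (0 : ℝ) ∈ Icc (0 : ℝ) 1 := left_mem_Icc.2 zero_le_one
    exact intervalIntegral.integral_add (intervalIntegrable_of_continuousOn_Icc hf h0 t.2)
      (intervalIntegrable_of_continuousOn_Icc (hh k) h0 t.2)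
  have hm0 := measurable_noisePath hBmeas n
  have hreal : ∀ g, (whiteNoiseLaw P B n g).real A
      = P.real {ω | primitivePath g + noisePath B n ω ∈ A} := fun g => by
    rw [whiteNoiseLaw_eq]
    exact map_measureReal_apply (hm0.const_add _) hA
  have hA' : MeasurableSet {y : PathSpace | primitivePath f + y ∈ A} :=
    (measurable_const_add _) hA
  have key := noisePath_le_average hB hBmeas hn (fun k => primitivePath (h k))
    (fun k => intervalIntegral.integral_same) (τ := τ)
    (fun k d t ht => (mul_le_mul_of_nonneg_left (sum_sq_pathIncrements_le (hh k) ht)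
      (Nat.cast_nonneg n)).trans (hτ k)) G
    (fun k l hkl x y hxy hg => by
      rw [primitivePath_sub (hh k), primitivePath_sub (hh l)]
      exact hG k l hkl x y hxy hg) hA'
  simp_rw [hreal, hadd, add_assoc, add_comm (primitivePath (h _))]
  exact key

/-- The mixture bound with a single component. It is used to discard the levels that later stages
may still change. -/
theorem whiteNoiseLaw_le_shift (hB : IsPreBrownianReal B P)
    (hBmeas : ∀ t, Measurable (B t)) {n : ℕ} (hn : n ≠ 0)
    {f g : ℝ → ℝ} (hf : ContinuousOn f (Icc 0 1)) (hg : ContinuousOn g (Icc 0 1)) {d : ℝ}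
    (hd : ∀ x ∈ Icc (0 : ℝ) 1, |g x - f x| ≤ d)
    {A : Set PathSpace} (hA : MeasurableSet A) :
    (whiteNoiseLaw P B n f).real A
      ≤ (whiteNoiseLaw P B n g).real A + √(Real.exp (n * d ^ 2) - 1) := by
  have hh : ContinuousOn (fun x => g x - f x) (Icc 0 1) := hg.sub hf
  have hint : ∫ x in (0 : ℝ)..1, (g x - f x) ^ 2 ≤ d ^ 2 := by
    have h0 : (0 : ℝ) ∈ Icc (0 : ℝ) 1 := left_mem_Icc.2 zero_le_one
    have h1 : (1 : ℝ) ∈ Icc (0 : ℝ) 1 := right_mem_Icc.2 zero_le_one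
    calc ∫ x in (0 : ℝ)..1, (g x - f x) ^ 2 ≤ ∫ x in (0 : ℝ)..1, d ^ 2 := by
          refine intervalIntegral.integral_mono_on zero_le_one
            (intervalIntegrable_of_continuousOn_Icc (hh.pow 2) h0 h1) intervalIntegrable_const
            fun x hx => ?_
          rw [← sq_abs]
          exact pow_le_pow_left₀ (abs_nonneg _) (hd x hx) 2
      _ = d ^ 2 := by simp
  have h := whiteNoiseLaw_le_average hB hBmeas hn (κ := Unit) hf (h := fun _ x => g x - f x)
    (fun _ => hh) (fun _ => mul_le_mul_of_nonneg_left hint (Nat.cast_nonneg n)) ∅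
    (fun k l hkl => absurd (Subsingleton.elim k l) hkl) hA
  simpa using h

end WhiteNoise

/-! ### Wavelet series with one coefficient in each level -/

theorem scaled_natCast (g : ℝ → ℝ) (l k : ℕ) (x : ℝ) :
    scaled g l k x = (2 : ℝ) ^ ((l : ℝ) / 2) * g (2 ^ l * x - k) := by
  simp [scaled]

/-- The size `2^{-l(s+1/2)}` of the level `l` coefficients of a function of smoothness `s`. -/
noncomputable def decay (s : ℝ) (l : ℕ) : ℝ := (2 : ℝ) ^ (-((l : ℝ) * (s + 1 / 2)))

theorem decay_pos (s : ℝ) (l : ℕ) : 0 < decay s l := Real.rpow_pos_of_pos two_pos _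

theorem decay_anti {s t : ℝ} (h : s ≤ t) (l : ℕ) : decay t l ≤ decay s l :=
  Real.rpow_le_rpow_of_exponent_le one_le_two <| by
    have : (0 : ℝ) ≤ l := Nat.cast_nonneg l
    nlinarith

theorem rpow_mul_decay (s : ℝ) (l : ℕ) :
    (2 : ℝ) ^ ((l : ℝ) * (s + 1 / 2)) * decay s l = 1 := by
  rw [decay, ← Real.rpow_add two_pos, add_neg_cancel, Real.rpow_zero]

theorem rpow_half_mul_decay (s : ℝ) (l : ℕ) :
    (2 : ℝ) ^ ((l : ℝ) / 2) * decay s l = ((2 : ℝ) ^ (-s)) ^ l := by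
  rw [decay, ← Real.rpow_add two_pos, ← Real.rpow_natCast, ← Real.rpow_mul two_pos.le]
  congr 1
  ring

theorem two_rpow_neg_lt_one {s : ℝ} (hs : 0 < s) : (2 : ℝ) ^ (-s) < 1 :=
  Real.rpow_lt_one_of_one_lt_of_neg one_lt_two (neg_lt_zero.2 hs)

theorem two_rpow_pos (s : ℝ) : 0 < (2 : ℝ) ^ s := Real.rpow_pos_of_pos two_pos s

theorem IsRegularWavelet.exists_ne_zero {φ ψ : ℝ → ℝ} {K N : ℕ} (hmra : IsOrthonormalMRA φ ψ)
    (hreg : IsRegularWavelet φ ψ K N) : ∃ y ∈ Icc (1 - (K : ℝ)) K, ψ y ≠ 0 := by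
  by_contra! h
  have hz : ∀ y, ψ y = 0 := fun y => by
    by_contra hy
    exact hy (h y (hreg.support_wavelet hy))
  have := hmra.orthonormal_wavelet 0 0
  simp [scaled, hz] at this

namespace IntervalWaveletBasis

variable {φ ψ : ℝ → ℝ} {N : ℕ} (W : IntervalWaveletBasis φ ψ N)

/-- Locations `k l` in the levels `l > j₀`, in the interior for all levels `l > N`. -/
def IsAdmissible (k : ℕ → ℕ) : Prop :=
  ∀ l, W.j₀ < l → k l < 2 ^ l ∧ (N < l → N ≤ k l ∧ k l + N < 2 ^ l)

/-- The wavelets at admissible locations are of size at most `C 2^{l/2}`. -/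
def IsSizeBound (C : ℝ) : Prop :=
  ∀ l k, W.j₀ < l → k < 2 ^ l → (N < l → N ≤ k ∧ k + N < 2 ^ l) → ∀ x ∈ Icc (0 : ℝ) 1,
    |W.wav l k x| ≤ C * (2 : ℝ) ^ ((l : ℝ) / 2)

/-- Boundedness of `ψ` is inherited from the interval basis: in a fine level, an interior wavelet is
continuous on `[0,1]` and contains a complete rescaled copy of `ψ`. -/
theorem exists_wavelet_bound (W : IntervalWaveletBasis φ ψ N) {K : ℕ} (hreg : IsRegularWavelet φ ψ K N) :
    ∃ D, ∀ y, |ψ y| ≤ D := by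
  set l := max W.j₀ (2 * (N + K)) + 1 with hl
  have hl0 : W.j₀ < l := by omega
  have hl1 : 2 * (N + K) < 2 ^ l := lt_of_lt_of_le (by omega) Nat.lt_two_pow_self.le
  obtain ⟨D, hD⟩ := isCompact_Icc.exists_bound_of_continuousOn
    (W.wav_continuous l (N + K) hl0 (by omega))
  refine ⟨max D 0, fun y => ?_⟩
  by_cases hy : ψ y = 0
  · simp [hy]
  have hy' := hreg.support_wavelet hy
  have hpos : (0 : ℝ) < 2 ^ l := by positivity
  have hcast : (2 : ℝ) * (N + K) < 2 ^ l := by exact_mod_cast hl1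
  have hN : (0 : ℝ) ≤ N := Nat.cast_nonneg N
  have hx : (y + (N + K)) / 2 ^ l ∈ Icc (0 : ℝ) 1 := by
    constructor
    · refine div_nonneg ?_ hpos.le
      linarith [hy'.1]
    · rw [div_le_one hpos]
      linarith [hy'.2]
  have h := hD _ hx
  rw [W.wav_interior l (N + K) hl0 (by omega) (by omega) _ hx, scaled_natCast] at h
  have h2 : (2 : ℝ) ^ l * ((y + (N + K)) / 2 ^ l) - ((N + K : ℕ) : ℝ) = y := by
    push_cast
    field_simp
    ring
  rw [h2, norm_mul, Real.norm_eq_abs, Real.norm_eq_abs, abs_of_pos (two_rpow_pos _)] at h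
  have h3 : (1 : ℝ) ≤ 2 ^ ((l : ℝ) / 2) := Real.one_le_rpow one_le_two (by positivity)
  calc |ψ y| ≤ 2 ^ ((l : ℝ) / 2) * |ψ y| := le_mul_of_one_le_left (abs_nonneg _) h3
    _ ≤ D := h
    _ ≤ max D 0 := le_max_left _ _

/-- Above level `N` admissible wavelets are rescaled copies of `ψ`. The levels up to `N` may involve
boundary functions, but these are finitely many continuous functions on a compact interval. -/
theorem exists_isSizeBound {K : ℕ} (hreg : IsRegularWavelet φ ψ K N) :
    ∃ C, 0 < C ∧ W.IsSizeBound C := by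
  obtain ⟨D, hD⟩ := W.exists_wavelet_bound hreg
  have hD0 : 0 ≤ D := (abs_nonneg _).trans (hD 0)
  have hex : ∀ l k, ∃ c, W.j₀ < l → k < 2 ^ l → ∀ x ∈ Icc (0 : ℝ) 1, ‖W.wav l k x‖ ≤ c := by
    intro l k
    by_cases h : W.j₀ < l ∧ k < 2 ^ l
    · obtain ⟨c, hc⟩ := isCompact_Icc.exists_bound_of_continuousOn (W.wav_continuous l k h.1 h.2)
      exact ⟨c, fun _ _ => hc⟩
    · exact ⟨0, fun h1 h2 => absurd ⟨h1, h2⟩ h⟩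
  choose c hc using hex
  set S := ∑ l ∈ Finset.range (N + 1), ∑ k ∈ Finset.range (2 ^ l), |c l k| with hS
  have hS0 : 0 ≤ S := Finset.sum_nonneg fun _ _ => Finset.sum_nonneg fun _ _ => abs_nonneg _
  refine ⟨S + D + 1, by positivity, fun l k hl hk hN x hx => ?_⟩
  have h1 : (1 : ℝ) ≤ 2 ^ ((l : ℝ) / 2) := Real.one_le_rpow one_le_two (by positivity)
  rcases lt_or_ge N l with h | h
  · rw [W.wav_interior l k hl (hN h).1 (hN h).2 x hx, scaled_natCast, abs_mul,
      abs_of_pos (two_rpow_pos _), mul_comm]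
    gcongr
    linarith [hD (2 ^ l * x - k)]
  · have h2 : |c l k| ≤ S :=
      (Finset.single_le_sum (f := fun k => |c l k|) (fun _ _ => abs_nonneg _)
        (Finset.mem_range.2 hk)).trans
      (Finset.single_le_sum (f := fun l => ∑ k ∈ Finset.range (2 ^ l), |c l k|)
        (fun _ _ => Finset.sum_nonneg fun _ _ => abs_nonneg _)
        (Finset.mem_range.2 (Nat.lt_succ_of_le h)))
    calc |W.wav l k x| ≤ c l k := hc l k hl hk x hx
      _ ≤ S + D + 1 := by linarith [le_abs_self (c l k)]
      _ ≤ _ := le_mul_of_one_le_right (by positivity) h1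

/-- The level `l` term of a series with one coefficient in each level. -/
noncomputable def seriesTerm (k : ℕ → ℕ) (b : ℕ → ℝ) (l : ℕ) (x : ℝ) : ℝ :=
  if W.j₀ < l then b l * W.wav l (k l) x else 0

/-- The series `α φ_{j₀,0} + ∑_{l > j₀} b_l ψ_{l,k_l}`. -/
noncomputable def series (α : ℝ) (k : ℕ → ℕ) (b : ℕ → ℝ) (x : ℝ) : ℝ :=
  α * W.scal 0 x + ∑' l, W.seriesTerm k b l x

variable {W} {C : ℝ} {k k' : ℕ → ℕ} {b b' : ℕ → ℝ} {s M : ℝ}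

theorem abs_seriesTerm_le (hC : W.IsSizeBound C) (hk : W.IsAdmissible k)
    (hM : 0 ≤ M) (hC0 : 0 < C) (hb : ∀ l, W.j₀ < l → |b l| ≤ M * decay s l)
    (l : ℕ) {x : ℝ} (hx : x ∈ Icc (0 : ℝ) 1) :
    |W.seriesTerm k b l x| ≤ M * C * ((2 : ℝ) ^ (-s)) ^ l := by
  unfold seriesTerm
  split_ifs with h
  · rw [abs_mul, ← rpow_half_mul_decay]
    calc |b l| * |W.wav l (k l) x| ≤ (M * decay s l) * (C * 2 ^ ((l : ℝ) / 2)) :=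
          mul_le_mul (hb l h) (hC l (k l) h (hk l h).1 (hk l h).2 x hx) (abs_nonneg _)
            (mul_nonneg hM (decay_pos _ _).le)
      _ = _ := by ring
  · rw [abs_zero]
    have := two_rpow_pos (-s)
    positivity

theorem summable_bound (hs : 0 < s) (A : ℝ) : Summable fun l : ℕ => A * ((2 : ℝ) ^ (-s)) ^ l :=
  (summable_geometric_of_lt_one (two_rpow_pos _).le (two_rpow_neg_lt_one hs)).mul_left A

theorem summable_seriesTerm (hC : W.IsSizeBound C) (hC0 : 0 < C) (hk : W.IsAdmissible k)
    (hM : 0 ≤ M) (hs : 0 < s) (hb : ∀ l, W.j₀ < l → |b l| ≤ M * decay s l)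
    {x : ℝ} (hx : x ∈ Icc (0 : ℝ) 1) : Summable fun l => W.seriesTerm k b l x :=
  .of_norm_bounded (summable_bound hs _) fun l => abs_seriesTerm_le hC hk hM hC0 hb l hx

theorem continuousOn_seriesTerm (hk : W.IsAdmissible k) (l : ℕ) :
    ContinuousOn (W.seriesTerm k b l) (Icc 0 1) := by
  unfold seriesTerm
  split_ifs with h
  · exact continuousOn_const.mul (W.wav_continuous l (k l) h (hk l h).1)
  · exact continuousOn_const

theorem continuousOn_scal_zero (W : IntervalWaveletBasis φ ψ N) :
    ContinuousOn (W.scal 0) (Icc 0 1) := W.scal_continuous 0 (by positivity)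

theorem continuousOn_series (hC : W.IsSizeBound C) (hC0 : 0 < C) (hk : W.IsAdmissible k)
    (hM : 0 ≤ M) (hs : 0 < s) (hb : ∀ l, W.j₀ < l → |b l| ≤ M * decay s l) (α : ℝ) :
    ContinuousOn (W.series α k b) (Icc 0 1) :=
  (continuousOn_const.mul W.continuousOn_scal_zero).add <|
    continuousOn_tsum (fun l => continuousOn_seriesTerm hk l) (summable_bound hs (M * C))
      fun l _ hx => abs_seriesTerm_le hC hk hM hC0 hb l hx

/-- Termwise integration, by domination with a geometric series. Orthonormality then yields the
coefficients of the series. -/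
theorem integral_series_mul (hC : W.IsSizeBound C) (hC0 : 0 < C) (hk : W.IsAdmissible k)
    (hM : 0 ≤ M) (hs : 0 < s) (hb : ∀ l, W.j₀ < l → |b l| ≤ M * decay s l) (α : ℝ)
    {e : ℝ → ℝ} (he : ContinuousOn e (Icc 0 1)) :
    ∫ x in (0 : ℝ)..1, W.series α k b x * e x
      = α * (∫ x in (0 : ℝ)..1, W.scal 0 x * e x)
        + ∑' l, ∫ x in (0 : ℝ)..1, W.seriesTerm k b l x * e x := by
  have h0 : (0 : ℝ) ∈ Icc (0 : ℝ) 1 := left_mem_Icc.2 zero_le_one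
  have h1 : (1 : ℝ) ∈ Icc (0 : ℝ) 1 := right_mem_Icc.2 zero_le_one
  obtain ⟨D, hD⟩ := isCompact_Icc.exists_bound_of_continuousOn he
  have hD0 : 0 ≤ D := (norm_nonneg _).trans (hD 0 h0)
  have hsub : uIoc (0 : ℝ) 1 ⊆ Icc 0 1 := by
    rw [uIoc_of_le zero_le_one]; exact Ioc_subset_Icc_self
  have hsum : HasSum (fun l => ∫ x in (0 : ℝ)..1, W.seriesTerm k b l x * e x)
      (∫ x in (0 : ℝ)..1, (∑' l, W.seriesTerm k b l x) * e x) := by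
    refine intervalIntegral.hasSum_integral_of_dominated_convergence
      (fun l _ => M * C * D * ((2 : ℝ) ^ (-s)) ^ l) (fun l => ?_) (fun l => ?_) ?_ ?_ ?_
    · exact ContinuousOn.aestronglyMeasurable
        (((continuousOn_seriesTerm hk l).mul he).mono hsub) measurableSet_uIoc
    · refine ae_of_all _ fun x hx => ?_
      rw [norm_mul]
      calc ‖W.seriesTerm k b l x‖ * ‖e x‖ ≤ (M * C * ((2 : ℝ) ^ (-s)) ^ l) * D :=
            mul_le_mul (abs_seriesTerm_le hC hk hM hC0 hb l (hsub hx)) (hD x (hsub hx))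
              (norm_nonneg _) (by have := two_rpow_pos (-s); positivity)
        _ = _ := by ring
    · exact ae_of_all _ fun _ _ => summable_bound hs _
    · exact intervalIntegrable_const
    · exact ae_of_all _ fun x hx =>
        (summable_seriesTerm hC hC0 hk hM hs hb (hsub hx)).hasSum.mul_right _
  rw [hsum.tsum_eq, ← intervalIntegral.integral_const_mul, ← intervalIntegral.integral_add]
  · refine intervalIntegral.integral_congr fun x _ => ?_
    simp only [series]
    ring
  · exact (intervalIntegrable_of_continuousOn_Icc (W.continuousOn_scal_zero.mul he) h0 h1).const_mul _
  · refine intervalIntegrable_of_continuousOn_Icc (ContinuousOn.mul ?_ he) h0 h1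
    exact continuousOn_tsum (fun l => continuousOn_seriesTerm hk l) (summable_bound hs (M * C))
      fun l _ hx => abs_seriesTerm_le hC hk hM hC0 hb l hx

theorem scalCoeff_series (hC : W.IsSizeBound C) (hC0 : 0 < C) (hk : W.IsAdmissible k)
    (hM : 0 ≤ M) (hs : 0 < s) (hb : ∀ l, W.j₀ < l → |b l| ≤ M * decay s l) (α : ℝ)
    {i : ℕ} (hi : i < 2 ^ W.j₀) :
    W.scalCoeff (W.series α k b) i = if i = 0 then α else 0 := by
  rw [scalCoeff, integral_series_mul hC hC0 hk hM hs hb α (W.scal_continuous i hi),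
    W.scal_scal 0 (by positivity) i hi]
  have hz : ∀ l, ∫ x in (0 : ℝ)..1, W.seriesTerm k b l x * W.scal i x = 0 := fun l => by
    unfold seriesTerm
    split_ifs with h
    · have : ∀ x, b l * W.wav l (k l) x * W.scal i x
          = b l * (W.scal i x * W.wav l (k l) x) := fun x => by ring
      simp_rw [this]
      rw [intervalIntegral.integral_const_mul, W.scal_wav i hi l (k l) h (hk l h).1, mul_zero]
    · simp
  simp [hz, eq_comm]

theorem wavCoeff_series (hC : W.IsSizeBound C) (hC0 : 0 < C) (hk : W.IsAdmissible k)
    (hM : 0 ≤ M) (hs : 0 < s) (hb : ∀ l, W.j₀ < l → |b l| ≤ M * decay s l) (α : ℝ)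
    {j i : ℕ} (hj : W.j₀ < j) (hi : i < 2 ^ j) :
    W.wavCoeff (W.series α k b) j i = if i = k j then b j else 0 := by
  rw [wavCoeff, integral_series_mul hC hC0 hk hM hs hb α (W.wav_continuous j i hj hi),
    W.scal_wav 0 (by positivity) j i hj hi, mul_zero, zero_add]
  have hz : ∀ l, ∫ x in (0 : ℝ)..1, W.seriesTerm k b l x * W.wav j i x
      = if l = j then (if i = k j then b j else 0) else 0 := fun l => by
    unfold seriesTerm
    by_cases h : W.j₀ < l
    · have : ∀ x, b l * W.wav l (k l) x * W.wav j i x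
          = b l * (W.wav l (k l) x * W.wav j i x) := fun x => by ring
      simp_rw [if_pos h, this]
      rw [intervalIntegral.integral_const_mul, W.wav_wav l (k l) h (hk l h).1 j i hj hi]
      by_cases hl : l = j
      · subst hl
        simp [eq_comm]
      · simp [hl]
    · have hl : l ≠ j := by rintro rfl; exact h hj
      simp [h, hl]
  simp_rw [hz]
  rw [tsum_ite_eq]

/-- Two series that agree below level `Λ` are uniformly close. -/
theorem abs_series_sub_series_le (hC : W.IsSizeBound C) (hC0 : 0 < C) (hk : W.IsAdmissible k)
    (hk' : W.IsAdmissible k') (hM : 0 ≤ M) (hs : 0 < s)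
    (hb : ∀ l, W.j₀ < l → |b l| ≤ M * decay s l) (hb' : ∀ l, W.j₀ < l → |b' l| ≤ M * decay s l)
    (α : ℝ) {Λ : ℕ} (hkk : ∀ l < Λ, W.j₀ < l → k l = k' l ∧ b l = b' l)
    {x : ℝ} (hx : x ∈ Icc (0 : ℝ) 1) :
    |W.series α k b x - W.series α k' b' x|
      ≤ 2 * M * C * (1 - (2 : ℝ) ^ (-s))⁻¹ * ((2 : ℝ) ^ (-s)) ^ Λ := by
  set q := (2 : ℝ) ^ (-s) with hq
  have hq0 : 0 < q := two_rpow_pos _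
  have hg : HasSum (fun l : ℕ => if Λ ≤ l then 2 * M * C * q ^ l else 0)
      (2 * M * C * (1 - q)⁻¹ * q ^ Λ) := by
    rw [← Function.Injective.hasSum_iff (add_left_injective Λ)]
    · have := (hasSum_geometric_of_lt_one hq0.le (two_rpow_neg_lt_one hs)).mul_left
        (2 * M * C * q ^ Λ)
      rw [mul_right_comm _ _ (q ^ Λ)]
      have hfun : (fun l : ℕ => if Λ ≤ l then 2 * M * C * q ^ l else 0) ∘ (fun l => l + Λ)
          = fun l => 2 * M * C * q ^ Λ * q ^ l := by
        funext l
        simp only [Function.comp, le_add_iff_nonneg_left, zero_le, if_true]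
        ring
      rwa [hfun]
    · intro l hl
      rw [if_neg]
      intro h
      exact hl ⟨l - Λ, Nat.sub_add_cancel h⟩
  have hd : W.series α k b x - W.series α k' b' x
      = ∑' l, (W.seriesTerm k b l x - W.seriesTerm k' b' l x) := by
    rw [Summable.tsum_sub (summable_seriesTerm hC hC0 hk hM hs hb hx)
      (summable_seriesTerm hC hC0 hk' hM hs hb' hx)]
    simp only [series]
    ring
  rw [hd, ← Real.norm_eq_abs]
  refine tsum_of_norm_bounded hg fun l => ?_
  split_ifs with h
  · have h1 := abs_seriesTerm_le hC hk hM hC0 hb l hx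
    have h2 := abs_seriesTerm_le hC hk' hM hC0 hb' l hx
    calc ‖W.seriesTerm k b l x - W.seriesTerm k' b' l x‖
        ≤ |W.seriesTerm k b l x| + |W.seriesTerm k' b' l x| := norm_sub_le _ _
      _ ≤ 2 * M * C * q ^ l := by rw [← hq] at h1 h2; linarith
  · rw [not_le] at h
    unfold seriesTerm
    split_ifs with hl
    · rw [(hkk l h hl).1, (hkk l h hl).2]
      simp
    · simp

/-- Changing the coefficient of a level where the series has none. -/
theorem series_update (hC : W.IsSizeBound C) (hC0 : 0 < C) (hk : W.IsAdmissible k)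
    (hM : 0 ≤ M) (hs : 0 < s) (hb : ∀ l, W.j₀ < l → |b l| ≤ M * decay s l) (α : ℝ)
    {c : ℕ} (hc : W.j₀ < c) (hbc : b c = 0) (i : ℕ) (a : ℝ) {x : ℝ} (hx : x ∈ Icc (0 : ℝ) 1) :
    W.series α (Function.update k c i) (Function.update b c a) x
      = W.series α k b x + a * W.wav c i x := by
  have hterm : ∀ l, W.seriesTerm (Function.update k c i) (Function.update b c a) l x
      = W.seriesTerm k b l x + if l = c then a * W.wav c i x else 0 := fun l => by
    unfold seriesTerm
    by_cases h : l = c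
    · subst h
      simp [hc, hbc]
    · simp [h]
  simp only [series, hterm]
  rw [Summable.tsum_add (summable_seriesTerm hC hC0 hk hM hs hb hx)
    ⟨_, hasSum_ite_eq c _⟩, tsum_ite_eq, add_assoc]

theorem truncation_series (hC : W.IsSizeBound C) (hC0 : 0 < C) (hk : W.IsAdmissible k)
    (hM : 0 ≤ M) (hs : 0 < s) (hb : ∀ l, W.j₀ < l → |b l| ≤ M * decay s l) (α : ℝ) (i j : ℕ) :
    W.truncation i j (W.series α k b)
      = W.series (if i = W.j₀ then α else 0) k
          (fun l => if l ∈ Finset.Icc (max i (W.j₀ + 1)) j then b l else 0) := by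
  ext x
  have h1 : ∑ m ∈ Finset.range (2 ^ W.j₀), W.scalCoeff (W.series α k b) m * W.scal m x
      = α * W.scal 0 x := by
    rw [Finset.sum_eq_single 0]
    · rw [scalCoeff_series hC hC0 hk hM hs hb α (by positivity), if_pos rfl]
    · intro m hm hm0
      rw [scalCoeff_series hC hC0 hk hM hs hb α (Finset.mem_range.1 hm), if_neg hm0, zero_mul]
    · intro h
      exact absurd (Finset.mem_range.2 (by positivity)) h
  have h2 : ∀ l ∈ Finset.Icc (max i (W.j₀ + 1)) j, ∑ m ∈ Finset.range (2 ^ l),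
      W.wavCoeff (W.series α k b) l m * W.wav l m x = b l * W.wav l (k l) x := by
    intro l hl
    have hl0 : W.j₀ < l := by
      have := (Finset.mem_Icc.1 hl).1
      omega
    rw [Finset.sum_eq_single (k l)]
    · rw [wavCoeff_series hC hC0 hk hM hs hb α hl0 (hk l hl0).1, if_pos rfl]
    · intro m hm hm0
      rw [wavCoeff_series hC hC0 hk hM hs hb α hl0 (Finset.mem_range.1 hm), if_neg hm0, zero_mul]
    · intro h
      exact absurd (Finset.mem_range.2 (hk l hl0).1) h
  rw [truncation, h1, Finset.sum_congr rfl h2, series]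
  congr 1
  · split_ifs <;> simp
  · rw [tsum_eq_sum (s := Finset.Icc (max i (W.j₀ + 1)) j)]
    · refine Finset.sum_congr rfl fun l hl => ?_
      have hl0 : W.j₀ < l := by
        have := (Finset.mem_Icc.1 hl).1
        omega
      simp only [seriesTerm, if_pos hl0, if_pos hl]
    · intro l hl
      simp only [seriesTerm, if_neg hl, zero_mul, ite_self]

theorem series_mem_holderBall (hC : W.IsSizeBound C) (hC0 : 0 < C) (hk : W.IsAdmissible k)
    (hM : 0 ≤ M) (hs : 0 < s) (hb : ∀ l, W.j₀ < l → |b l| ≤ M * decay s l) :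
    W.series M k b ∈ W.holderBall s M := by
  refine ⟨continuousOn_series hC hC0 hk hM hs hb M, max_le ?_ ?_⟩
  · refine iSup₂_le fun i hi => ENNReal.ofReal_le_ofReal ?_
    rw [scalCoeff_series hC hC0 hk hM hs hb M (Finset.mem_range.1 hi)]
    split_ifs
    · rw [abs_of_nonneg hM]
    · simpa using hM
  · refine iSup₂_le fun j hj => iSup₂_le fun i hi => ENNReal.ofReal_le_ofReal ?_
    rw [wavCoeff_series hC hC0 hk hM hs hb M hj (Finset.mem_range.1 hi)]
    split_ifs
    · calc _ ≤ (2 : ℝ) ^ ((j : ℝ) * (s + 1 / 2)) * (M * decay s j) := by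
            gcongr
            exact hb j hj
        _ = M := by rw [mul_left_comm, rpow_mul_decay, mul_one]
    · simpa using hM

/-- The scaling coefficient `M` settles the window that starts at `j₀`. Every other window needs
just one coefficient within the factor `ε` of the maximal size. -/
theorem series_mem_weaklySelfSimilar (hC : W.IsSizeBound C) (hC0 : 0 < C)
    (hk : W.IsAdmissible k) (hM : 0 ≤ M) (hs : 0 < s)
    (hb : ∀ l, W.j₀ < l → |b l| ≤ M * decay s l) {ε : ℝ} (hε : ε ∈ Ioo (0 : ℝ) 1) {ρ : ℕ → ℕ}
    (hwin : ∀ j, W.j₀ < j → ∃ l, j ≤ l ∧ l ≤ ρ j * j ∧ ε * M * decay s l ≤ |b l|) :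
    W.series M k b ∈ W.weaklySelfSimilar ε ρ s M := by
  refine ⟨series_mem_holderBall hC hC0 hk hM hs hb, fun j hj => ?_⟩
  rw [truncation_series hC hC0 hk hM hs hb]
  have hb' : ∀ l, W.j₀ < l →
      |if l ∈ Finset.Icc (max j (W.j₀ + 1)) (ρ j * j) then b l else 0| ≤ M * decay s l := by
    intro l hl
    split_ifs
    · exact hb l hl
    · rw [abs_zero]
      exact mul_nonneg hM (decay_pos _ _).le
  rcases hj.eq_or_lt with rfl | hlt
  · refine le_max_of_le_left (le_iSup₂_of_le 0 (Finset.mem_range.2 (by positivity)) ?_)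
    rw [scalCoeff_series hC hC0 hk hM hs hb' _ (by positivity), if_pos rfl, if_pos rfl,
      abs_of_nonneg hM]
    exact ENNReal.ofReal_le_ofReal (mul_le_of_le_one_left hM hε.2.le)
  · obtain ⟨l, hl1, hl2, hl3⟩ := hwin j hlt
    have hl0 : W.j₀ < l := hlt.trans_le hl1
    refine le_max_of_le_right (le_iSup₂_of_le l hl0 (le_iSup₂_of_le (k l)
      (Finset.mem_range.2 (hk l hl0).1) (ENNReal.ofReal_le_ofReal ?_)))
    rw [wavCoeff_series hC hC0 hk hM hs hb' _ hl0 (hk l hl0).1, if_pos rfl,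
      if_pos (Finset.mem_Icc.2 ⟨max_le hl1 hl0, hl2⟩)]
    calc ε * M = (2 : ℝ) ^ ((l : ℝ) * (s + 1 / 2)) * (ε * M * decay s l) := by
          rw [mul_left_comm, rpow_mul_decay, mul_one]
      _ ≤ _ := by gcongr

end IntervalWaveletBasis

/-! ### Hiding a wavelet at a random location -/

namespace IntervalWaveletBasis

variable {Ω : Type*} [MeasurableSpace Ω] {P : Measure Ω} {B : ℝ≥0 → Ω → ℝ}
  {φ ψ : ℝ → ℝ} {K N : ℕ} (W : IntervalWaveletBasis φ ψ N)

/-- The dyadic points of level `c` in the unit interval. -/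
noncomputable def dyadicGrid (c : ℕ) : Finset unitInterval :=
  (Finset.range (2 ^ c + 1)).image fun i : ℕ => projIcc (0 : ℝ) 1 zero_le_one ((i : ℝ) / 2 ^ c)

theorem exists_mem_Ioc_of_integral_ne_zero {h : ℝ → ℝ} {x y : ℝ} (hxy : x ≤ y)
    (hint : ∫ u in x..y, h u ≠ 0) : ∃ u ∈ Ioc x y, h u ≠ 0 := by
  by_contra! hz
  refine hint (intervalIntegral.integral_zero_ae (ae_of_all _ fun u hu => hz u ?_))
  rwa [uIoc_of_le hxy] at hu

/-- Between two neighbouring dyadic points, at most one of two distant wavelets is non-zero. -/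
theorem integral_wav_mul_eq_zero (hreg : IsRegularWavelet φ ψ K N) {c : ℕ} (hc : W.j₀ < c)
    {i j : ℕ} (hi : N ≤ i) (hij : i + 2 * K ≤ j) (hj : j + N < 2 ^ c) (hj' : i + K ≤ 2 ^ c)
    (a : ℝ) {x y : unitInterval} (hxy : x < y) (hG : ∀ g ∈ dyadicGrid c, g ≤ x ∨ y ≤ g) :
    (∫ u in (x : ℝ)..y, a * W.wav c i u) * (∫ u in (x : ℝ)..y, a * W.wav c j u) = 0 := by
  by_contra hne
  have hxy' : (x : ℝ) ≤ y := hxy.le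
  have hsupp : ∀ m : ℕ, N ≤ m → m + N < 2 ^ c → (∫ u in (x : ℝ)..y, a * W.wav c m u) ≠ 0 →
      ∃ u ∈ Ioc (x : ℝ) y, 2 ^ c * u - m ∈ Icc (1 - (K : ℝ)) K := by
    intro m hm hm' hint
    obtain ⟨u, hu, hne⟩ := exists_mem_Ioc_of_integral_ne_zero hxy' hint
    refine ⟨u, hu, hreg.support_wavelet ?_⟩
    have hu' : u ∈ Icc (0 : ℝ) 1 := ⟨x.2.1.trans hu.1.le, hu.2.trans y.2.2⟩
    rw [W.wav_interior c m hc hm hm' u hu', scaled_natCast] at hne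
    exact right_ne_zero_of_mul (right_ne_zero_of_mul hne)
  obtain ⟨u, hu, hu'⟩ := hsupp i hi (by omega) (left_ne_zero_of_mul hne)
  obtain ⟨v, hv, hv'⟩ := hsupp j (by omega) hj (right_ne_zero_of_mul hne)
  have hpos : (0 : ℝ) < 2 ^ c := by positivity
  have hle : ((i : ℝ) + K) ≤ 2 ^ c := by exact_mod_cast hj'
  have hij' : (i : ℝ) + 2 * K ≤ j := by exact_mod_cast hij
  -- The right end of the support of the first wavelet. It lies strictly between `x` and `y` if both
  -- integrals are non-zero, yet it is a grid point.
  have hmem : ((i : ℝ) + K) / 2 ^ c ∈ Icc (0 : ℝ) 1 :=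
    ⟨by positivity, (div_le_one hpos).2 hle⟩
  have hg : (⟨((i : ℝ) + K) / 2 ^ c, hmem⟩ : unitInterval) ∈ dyadicGrid c := by
    refine Finset.mem_image.2 ⟨i + K, Finset.mem_range.2 (by omega), ?_⟩
    rw [Nat.cast_add, projIcc_of_mem zero_le_one hmem]
  have h1 : (x : ℝ) < ((i : ℝ) + K) / 2 ^ c := by
    rw [lt_div_iff₀ hpos]
    nlinarith [hu.1, hu'.2]
  have h2 : ((i : ℝ) + K) / 2 ^ c < y := by
    rw [div_lt_iff₀ hpos]
    nlinarith [hv.2, hv'.1]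
  rcases hG _ hg with h | h
  · exact absurd (show ((i : ℝ) + K) / 2 ^ c ≤ x from h) (not_le.2 h1)
  · exact absurd (show (y : ℝ) ≤ ((i : ℝ) + K) / 2 ^ c from h) (not_le.2 h2)

/-- A wavelet of a suitable location in a fine level can be added to `f` almost unnoticed. -/
theorem exists_hidden_wavelet (hreg : IsRegularWavelet φ ψ K N) (hK : 0 < K)
    (hB : IsPreBrownianReal B P) (hBmeas : ∀ t, Measurable (B t)) {n : ℕ} (hn : n ≠ 0)
    {f : ℝ → ℝ} (hf : ContinuousOn f (Icc 0 1)) {c : ℕ} (hc : W.j₀ < c) {p : ℕ} (hp : 0 < p)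
    (hpc : 2 * N + 2 * K + 2 * K * p ≤ 2 ^ c) {a τ : ℝ} (hτ : n * a ^ 2 ≤ τ)
    {A : Set PathSpace} (hA : MeasurableSet A) :
    ∃ i, N + K ≤ i ∧ i + N + K ≤ 2 ^ c ∧
      (whiteNoiseLaw P B n f).real A
        ≤ (whiteNoiseLaw P B n fun x => f x + a * W.wav c i x).real A
          + √((Real.exp τ - 1) / p) := by
  have : NeZero p := ⟨hp.ne'⟩
  -- The offset `N + K` keeps the supports inside the interval and away from boundary functions; the
  -- spacing `2K` keeps them disjoint.
  set loc : Fin p → ℕ := fun i => N + K + 2 * K * i with hloc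
  have hbound : ∀ i, loc i + N + K + 2 * K ≤ 2 ^ c := fun i => by
    have : 2 * K * ((i : ℕ) + 1) ≤ 2 * K * p := Nat.mul_le_mul_left _ i.2
    simp only [hloc]
    nlinarith
  have hcont : ∀ i, ContinuousOn (fun x => a * W.wav c (loc i) x) (Icc 0 1) := fun i =>
    continuousOn_const.mul (W.wav_continuous c (loc i) hc (by have := hbound i; omega))
  have hint : ∀ i, n * ∫ x in (0 : ℝ)..1, (a * W.wav c (loc i) x) ^ 2 ≤ τ := fun i => by
    have h := W.wav_wav c (loc i) hc (by have := hbound i; omega) c (loc i) hc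
      (by have := hbound i; omega)
    have h2 : ∀ x, (a * W.wav c (loc i) x) ^ 2
        = a ^ 2 * (W.wav c (loc i) x * W.wav c (loc i) x) := fun x => by ring
    simp_rw [h2]
    rw [intervalIntegral.integral_const_mul, h]
    simpa using hτ
  have hsep : ∀ i j : Fin p, i < j → loc i + 2 * K ≤ loc j := fun i j hij => by
    have : 2 * K * ((i : ℕ) + 1) ≤ 2 * K * j := Nat.mul_le_mul_left _ hij
    simp only [hloc]
    nlinarith
  have hmix := whiteNoiseLaw_le_average hB hBmeas hn hf hcont hint (dyadicGrid c)
    (fun i j hij x y hxy hg => by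
      have hbi := hbound i
      have hbj := hbound j
      rcases lt_or_gt_of_ne hij with h | h
      · exact W.integral_wav_mul_eq_zero hreg hc (by simp only [hloc]; omega) (hsep i j h)
          (by omega) (by omega) a hxy hg
      · rw [mul_comm]
        exact W.integral_wav_mul_eq_zero hreg hc (by simp only [hloc]; omega) (hsep j i h)
          (by omega) (by omega) a hxy hg) hA
  rw [Fintype.card_fin] at hmix
  have hp' : (0 : ℝ) < p := by exact_mod_cast hp
  -- The best location does at least as well as the average over all locations.
  obtain ⟨i, -, hi⟩ := Finset.exists_max_image Finset.univ
    (fun i => (whiteNoiseLaw P B n fun x => f x + a * W.wav c (loc i) x).real A)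
    Finset.univ_nonempty
  refine ⟨loc i, by simp only [hloc]; omega, by have := hbound i; omega, hmix.trans ?_⟩
  gcongr
  rw [inv_mul_le_iff₀ hp']
  refine (Finset.sum_le_card_nsmul _ _ _ hi).trans ?_
  simp

/-- Interior wavelets of every level attain a value of the order of their size. -/
theorem exists_wav_eq {y : ℝ} (hy : y ∈ Icc (1 - (K : ℝ)) K) (hK : 0 < K) {c i : ℕ}
    (hc : W.j₀ < c) (hi : N + K ≤ i) (hi' : i + N + K ≤ 2 ^ c) :
    ∃ x ∈ Icc (0 : ℝ) 1, W.wav c i x = (2 : ℝ) ^ ((c : ℝ) / 2) * ψ y := by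
  have hpos : (0 : ℝ) < 2 ^ c := by positivity
  have h1 : (N : ℝ) + K ≤ i := by exact_mod_cast hi
  have h2 : (i : ℝ) + N + K ≤ 2 ^ c := by exact_mod_cast hi'
  have hN : (0 : ℝ) ≤ N := Nat.cast_nonneg N
  have hx : (y + i) / 2 ^ c ∈ Icc (0 : ℝ) 1 :=
    ⟨div_nonneg (by linarith [hy.1]) hpos.le, (div_le_one hpos).2 (by linarith [hy.2])⟩
  refine ⟨_, hx, ?_⟩
  rw [W.wav_interior c i hc (by omega) (by omega) _ hx, scaled_natCast]
  congr 2
  field_simp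
  ring

end IntervalWaveletBasis

/-! ### The choice of scales -/

theorem rate_le_of_le {s κ x : ℝ} {n : ℕ} (hs : 0 < s) (hκ : 0 < κ) (hx : 0 < x)
    (h : κ * x ≤ n / Real.log n) :
    rate s n ≤ κ ^ (-(s / (2 * s + 1))) * x ^ (-(s / (2 * s + 1))) := by
  have hθ : 0 < s / (2 * s + 1) := by positivity
  rw [rate, ← Real.mul_rpow hκ.le hx.le]
  exact Real.rpow_le_rpow_of_nonpos (by positivity) h (neg_nonpos.2 hθ.le)

theorem sq_decay (s : ℝ) (c : ℕ) :
    decay s c ^ 2 * (2 : ℝ) ^ ((c : ℝ) * (2 * s + 1)) = 1 := by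
  rw [decay, ← Real.rpow_natCast, ← Real.rpow_mul two_pos.le, ← Real.rpow_add two_pos]
  rw [show -((c : ℝ) * (s + 1 / 2)) * ((2 : ℕ) : ℝ) + c * (2 * s + 1) = 0 by push_cast; ring,
    Real.rpow_zero]

/-- For `n / log n` of order `2^{c(2t+1)}` with `t = s - E r/(2c)`, the rate for `s` falls below the
wavelet height `2^{-ct}` by a factor that is geometric in `r` and independent of `c`. -/
theorem rpow_gap_eq {s E r : ℝ} (hs : 0 < s) {c : ℕ} (hc : 0 < c) :
    ((2 : ℝ) ^ ((c : ℝ) * (2 * (s - E * r / (2 * c)) + 1))) ^ (-(s / (2 * s + 1)))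
      = (2 : ℝ) ^ (-((c : ℝ) * (s - E * r / (2 * c)))) * (2 : ℝ) ^ (-(E * r / (2 * (2 * s + 1)))) := by
  have hc' : (c : ℝ) ≠ 0 := by exact_mod_cast hc.ne'
  have hs' : 2 * s + 1 ≠ 0 := by positivity
  rw [← Real.rpow_mul two_pos.le, ← Real.rpow_add two_pos]
  congr 1
  field_simp
  ring

theorem eventually_le_two_pow (x : ℝ) : ∀ᶠ c : ℕ in atTop, x ≤ (2 : ℝ) ^ c :=
  (tendsto_pow_atTop_atTop_of_one_lt one_lt_two).eventually_ge_atTop x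

set_option maxHeartbeats 1600000 in
/-- Sample sizes `n` at which a level `c` wavelet of smoothness `s - E r / (2c)` can be hidden,
although it is larger than the rate for the smoothness `s`. -/
theorem exists_scales {s smax smin M D δ E y T : ℝ} (hs : 0 < s) (hsmax : s ≤ smax) (hM : 0 < M)
    (hD : 0 < D) (hδ : 0 < δ) (hE : 0 < E) (hy : 0 < y) (hT : 0 ≤ T) (n₀ N : ℕ) {K β : ℕ}
    (hK : 0 < K) (hβ : smax + 2 ≤ β * smin) :
    ∃ r₀ : ℕ, ∀ r ≥ r₀, ∀ᶠ c : ℕ in atTop, ∃ (n p : ℕ) (τ : ℝ), n₀ ≤ n ∧ n ≠ 0 ∧ 0 < p ∧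
      2 * N + 2 * K + 2 * K * p ≤ 2 ^ c ∧
      n * (M * decay (s - E * r / (2 * c)) c) ^ 2 ≤ τ ∧
      √((Real.exp τ - 1) / p) ≤ δ ∧
      √(Real.exp (n * (T * ((2 : ℝ) ^ (-smin)) ^ (β * c)) ^ 2) - 1) ≤ δ ∧
      2 * (D * rate s n) + T * ((2 : ℝ) ^ (-smin)) ^ (β * c)
        < M * y * (2 : ℝ) ^ (-((c : ℝ) * (s - E * r / (2 * c)))) := by
  have hsmax0 : 0 < smax := hs.trans_le hsmax
  set L := Real.log 2 with hL
  have hL0 : 0 < L := Real.log_pos one_lt_two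
  have hL1 : L ≤ 1 := by
    have := Real.log_two_lt_d9
    linarith
  -- Chosen so that `κ X ≤ n / log n` below: `n ≥ v / 2` gives the factor `4 M²`, and `n ≤ 2^{c(2
  -- smax + 3)}` gives the factor `2 smax + 3`.
  set κ : ℝ := 1 / (4 * M ^ 2 * (2 * smax + 3)) with hκ
  have hκ0 : 0 < κ := by positivity
  set θ := s / (2 * s + 1) with hθ
  set q : ℝ := (2 : ℝ) ^ (-(E / (2 * (2 * s + 1)))) with hq
  have hq0 : 0 < q := two_rpow_pos _
  have hq1 : q < 1 := two_rpow_neg_lt_one (by positivity)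
  obtain ⟨r₀, hr₀⟩ : ∃ r₀ : ℕ, ∀ r ≥ r₀, 2 * (D * κ ^ (-θ)) * q ^ r < M * y / 4 := by
    have h := (tendsto_pow_atTop_nhds_zero_of_lt_one hq0.le hq1).const_mul (2 * (D * κ ^ (-θ)))
    rw [mul_zero] at h
    exact eventually_atTop.1 (h.eventually_lt_const (by positivity))
  refine ⟨r₀, fun r hr => ?_⟩
  have hhalf : Tendsto (fun c : ℕ => ((1 : ℝ) / 2) ^ c) atTop (𝓝 0) :=
    tendsto_pow_atTop_nhds_zero_of_lt_one (by norm_num) (by norm_num)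
  have hroot : Tendsto (fun c : ℕ => ((2 : ℝ) ^ (-(1 / 2 : ℝ))) ^ c) atTop (𝓝 0) :=
    tendsto_pow_atTop_nhds_zero_of_lt_one (two_rpow_pos _).le (two_rpow_neg_lt_one (by norm_num))
  have e3 : ∀ᶠ c : ℕ in atTop, E * r / (2 * s) ≤ c :=
    tendsto_natCast_atTop_atTop.eventually_ge_atTop _
  have e5 : ∀ᶠ c : ℕ in atTop, 8 * K * ((2 : ℝ) ^ (-(1 / 2 : ℝ))) ^ c ≤ δ ^ 2 := by
    have h := hroot.const_mul (8 * (K : ℝ))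
    rw [mul_zero] at h
    exact h.eventually_le_const (by positivity)
  have e6 : ∀ᶠ c : ℕ in atTop, T * ((1 : ℝ) / 2) ^ c < M * y / 4 := by
    have h := hhalf.const_mul T
    rw [mul_zero] at h
    exact h.eventually_lt_const (by positivity)
  have e7 : ∀ᶠ c : ℕ in atTop, Real.exp (T ^ 2 * ((1 : ℝ) / 2) ^ c) ≤ 1 + δ ^ 2 := by
    have h := (Real.continuous_exp.tendsto _).comp (hhalf.const_mul (T ^ 2))
    rw [mul_zero, Real.exp_zero] at h
    exact h.eventually_le_const (by nlinarith)
  filter_upwards [eventually_gt_atTop 0, e3, e5, e6, e7, eventually_le_two_pow (1 / M ^ 2),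
    eventually_le_two_pow ((2 * n₀ + 4) * (2 * M ^ 2) / L),
    eventually_le_two_pow (2 * (2 * N + 2 * K)), eventually_le_two_pow (8 * K)]
    with c hc e3 e5 e6 e7 e2 e1 e4 e4'
  have hc0 : (0 : ℝ) < c := by exact_mod_cast hc
  have hc1 : (1 : ℝ) ≤ c := by exact_mod_cast hc
  set s' := s - E * r / (2 * c) with hs'
  have hs'0 : 0 ≤ s' := by
    rw [div_le_iff₀ (by positivity)] at e3
    rw [hs', sub_nonneg, div_le_iff₀ (by positivity)]
    linarith
  have hs's : s' ≤ smax := by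
    have : 0 ≤ E * r / (2 * c) := by positivity
    linarith
  set X := (2 : ℝ) ^ ((c : ℝ) * (2 * s' + 1)) with hX
  have hX0 : 0 < X := two_rpow_pos _
  have hcX : (2 : ℝ) ^ c ≤ X := by
    rw [hX, ← Real.rpow_natCast]
    exact Real.rpow_le_rpow_of_exponent_le one_le_two
      (le_mul_of_one_le_right hc0.le (by linarith))
  -- The sample size before rounding. It makes the signal energy `c log 2 / 2`, so that `e^τ =
  -- 2^{c/2}` is small against the number of locations, which is of order `2^c`.
  set v := c * L / 2 * X / M ^ 2 with hv
  have hv0 : 0 < v := by positivity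
  have hv1 : 2 * n₀ + 4 ≤ v := by
    rw [div_le_iff₀ hL0] at e1
    rw [hv, le_div_iff₀ (by positivity)]
    have : L * 2 ^ c ≤ c * L * X := by
      calc L * 2 ^ c ≤ L * X := by gcongr
        _ ≤ c * (L * X) := le_mul_of_one_le_left (by positivity) hc1
        _ = c * L * X := by ring
    linarith
  have hvup : v ≤ (2 : ℝ) ^ ((c : ℝ) * (2 * smax + 3)) := by
    have h1 : (c : ℝ) ≤ 2 ^ c := by exact_mod_cast (Nat.lt_two_pow_self (n := c)).le
    have h2 : X ≤ (2 : ℝ) ^ ((c : ℝ) * (2 * smax + 1)) :=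
      Real.rpow_le_rpow_of_exponent_le one_le_two (by gcongr)
    calc v = (c * (L / 2)) * (1 / M ^ 2) * X := by rw [hv]; ring
      _ ≤ 2 ^ c * 2 ^ c * (2 : ℝ) ^ ((c : ℝ) * (2 * smax + 1)) := by
          gcongr
          exact (mul_le_of_le_one_right hc0.le (by linarith)).trans h1
      _ = _ := by
          rw [← Real.rpow_natCast, ← Real.rpow_add two_pos, ← Real.rpow_add two_pos]
          congr 1
          ring
  set n := ⌊v⌋₊ with hn
  have hnv : (n : ℝ) ≤ v := Nat.floor_le hv0.le
  have hnv' : v / 2 ≤ n := by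
    have := Nat.lt_floor_add_one v
    have h0 : (0 : ℝ) ≤ n₀ := Nat.cast_nonneg _
    rw [← hn] at this
    linarith
  have hn0 : (n₀ : ℝ) + 2 ≤ n := by linarith
  have hn0' : n₀ + 2 ≤ n := by exact_mod_cast hn0
  have hnpos : (0 : ℝ) < n := by linarith [(Nat.cast_nonneg n₀ : (0 : ℝ) ≤ n₀)]
  set p := 2 ^ c / (4 * K) with hp
  have hK' : (0 : ℝ) < K := by exact_mod_cast hK
  have hpup : 4 * K * p ≤ 2 ^ c := Nat.mul_div_le _ _
  have hplow : (2 : ℝ) ^ c ≤ 8 * K * p := by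
    have h1 : 2 ^ c < 4 * K * (p + 1) := by
      rw [mul_add, mul_one]
      exact Nat.lt_mul_div_succ _ (by positivity)
    have h2 : (2 : ℝ) ^ c < 4 * K * (p + 1) := by exact_mod_cast h1
    linarith
  have hp0 : (0 : ℝ) < p := by
    have : (0 : ℝ) < 8 * K * p := lt_of_lt_of_le (by positivity) hplow
    exact pos_of_mul_pos_right this (by positivity)
  have hE2 : (2 : ℝ) ^ ((c : ℝ) / 2) = 2 ^ c * ((2 : ℝ) ^ (-(1 / 2 : ℝ))) ^ c := by
    rw [← Real.rpow_natCast, ← Real.rpow_natCast, ← Real.rpow_mul two_pos.le,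
      ← Real.rpow_add two_pos]
    congr 1
    ring
  -- The choice of `β` makes the tail so small that its energy `n t²` is at most `T² 2^{-c}`, since
  -- `n ≤ 2^{c(2 smax + 3)}`.
  have htail : T * ((2 : ℝ) ^ (-smin)) ^ (β * c) ≤ T * (2 : ℝ) ^ (-((c : ℝ) * (smax + 2))) := by
    gcongr
    rw [← Real.rpow_natCast, ← Real.rpow_mul two_pos.le]
    refine Real.rpow_le_rpow_of_exponent_le one_le_two ?_
    have := mul_le_mul_of_nonneg_left hβ hc0.le
    push_cast
    linarith
  set t := T * ((2 : ℝ) ^ (-smin)) ^ (β * c) with ht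
  have ht0 : 0 ≤ t := mul_nonneg hT (pow_nonneg (two_rpow_pos _).le _)
  have hpow : ∀ z : ℝ, ((1 : ℝ) / 2) ^ c * (2 : ℝ) ^ z = (2 : ℝ) ^ (z - c) := fun z => by
    rw [one_div, inv_pow, Real.rpow_sub two_pos, Real.rpow_natCast]
    ring
  clear_value p n
  refine ⟨n, p, c * L / 2, by omega, by omega, by exact_mod_cast hp0, ?_, ?_, ?_, ?_, ?_⟩
  · have h : 2 * (2 * N + 2 * K) ≤ 2 ^ c := by exact_mod_cast e4
    have h2 : 2 * (2 * K * p) = 4 * K * p := by ring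
    linarith
  · have h := sq_decay s' c
    rw [← hX] at h
    calc n * (M * decay s' c) ^ 2 ≤ v * (M * decay s' c) ^ 2 := by gcongr
      _ = c * L / 2 * (decay s' c ^ 2 * X) := by rw [hv]; field_simp
      _ = c * L / 2 := by rw [h, mul_one]
  · refine Real.sqrt_le_iff.2 ⟨hδ.le, le_trans ?_ e5⟩
    have hexp : Real.exp (c * L / 2) = (2 : ℝ) ^ ((c : ℝ) / 2) := by
      rw [Real.rpow_def_of_pos two_pos, ← hL]
      congr 1
      ring
    rw [div_le_iff₀ hp0, hexp, hE2]
    have h3 : 0 < ((2 : ℝ) ^ (-(1 / 2 : ℝ))) ^ c := pow_pos (two_rpow_pos _) _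
    calc 2 ^ c * ((2 : ℝ) ^ (-(1 / 2 : ℝ))) ^ c - 1
        ≤ 8 * K * p * ((2 : ℝ) ^ (-(1 / 2 : ℝ))) ^ c := by
          have := mul_le_mul_of_nonneg_right hplow h3.le
          linarith
      _ = 8 * K * ((2 : ℝ) ^ (-(1 / 2 : ℝ))) ^ c * p := by ring
  · refine Real.sqrt_le_iff.2 ⟨hδ.le, ?_⟩
    rw [sub_le_iff_le_add']
    refine le_trans (Real.exp_le_exp.2 ?_) e7
    calc n * t ^ 2 ≤ (2 : ℝ) ^ ((c : ℝ) * (2 * smax + 3))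
          * (T * (2 : ℝ) ^ (-((c : ℝ) * (smax + 2)))) ^ 2 := by
          gcongr
          exact hnv.trans hvup
      _ = T ^ 2 * ((1 : ℝ) / 2) ^ c := by
          have h := hpow 0
          rw [Real.rpow_zero, mul_one] at h
          rw [h, mul_pow, mul_left_comm, ← Real.rpow_natCast ((2 : ℝ) ^ (-((c : ℝ) * (smax + 2)))),
            ← Real.rpow_mul two_pos.le, ← Real.rpow_add two_pos]
          congr 2
          push_cast
          ring
  · have hlogn : 0 < Real.log n := Real.log_pos (by linarith [(Nat.cast_nonneg n₀ : (0 : ℝ) ≤ n₀)])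
    have hlog : Real.log n ≤ c * (2 * smax + 3) * L := by
      rw [hL, ← Real.log_rpow two_pos]
      exact Real.log_le_log hnpos (hnv.trans hvup)
    have hratio : κ * X ≤ n / Real.log n := by
      rw [le_div_iff₀ hlogn]
      calc κ * X * Real.log n ≤ κ * X * (c * (2 * smax + 3) * L) := by gcongr
        _ = v / 2 := by rw [hκ, hv]; field_simp; ring
        _ ≤ n := hnv'
    have hrate := rate_le_of_le hs hκ0 hX0 hratio
    rw [hX, hs', rpow_gap_eq hs hc, ← hs', ← hθ] at hrate
    have hqr : (2 : ℝ) ^ (-(E * r / (2 * (2 * s + 1)))) = q ^ r := by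
      rw [hq, ← Real.rpow_natCast, ← Real.rpow_mul two_pos.le]
      congr 1
      ring
    rw [hqr] at hrate
    set Z := (2 : ℝ) ^ (-((c : ℝ) * s')) with hZ
    have hZ0 : 0 < Z := two_rpow_pos _
    have h1 : 2 * (D * rate s n) ≤ M * y / 4 * Z := by
      calc 2 * (D * rate s n) ≤ 2 * (D * (κ ^ (-θ) * (Z * q ^ r))) := by gcongr
        _ = 2 * (D * κ ^ (-θ)) * q ^ r * Z := by ring
        _ ≤ M * y / 4 * Z := by
            gcongr
            exact (hr₀ r hr).le
    have h2 : t ≤ M * y / 4 * Z := by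
      calc t ≤ T * (2 : ℝ) ^ (-((c : ℝ) * (smax + 2))) := htail
        _ ≤ T * ((1 / 2) ^ c * Z) := by
            gcongr
            rw [hZ, hpow]
            refine Real.rpow_le_rpow_of_exponent_le one_le_two ?_
            have := mul_le_mul_of_nonneg_left (show s' + 1 ≤ smax + 2 by linarith) hc0.le
            linarith
        _ = T * (1 / 2) ^ c * Z := by ring
        _ ≤ M * y / 4 * Z := by gcongr
    have : 0 < M * y * Z := by positivity
    linarith

/-! ### Stages of the construction -/

/-- Coefficients of size `M 2^{-l(s+1/2)}` in the even levels. -/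
noncomputable def evenTail (s M : ℝ) (l : ℕ) : ℝ := if Even l then M * decay s l else 0

theorem abs_evenTail_le {s M : ℝ} (hM : 0 ≤ M) (l : ℕ) : |evenTail s M l| ≤ M * decay s l := by
  have := mul_nonneg hM (decay_pos s l).le
  unfold evenTail
  split_ifs
  · rw [abs_of_nonneg this]
  · rwa [abs_zero]

theorem abs_evenTail_of_even {s M : ℝ} (hM : 0 ≤ M) {l : ℕ} (hl : Even l) :
    |evenTail s M l| = M * decay s l := by
  rw [evenTail, if_pos hl, abs_of_nonneg (mul_nonneg hM (decay_pos s l).le)]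

/-- The slack `ε = 2^{-E}` in the self-similarity condition tolerates a smoothness gap of up to `E /
l` in level `l`. -/
theorem rpow_mul_decay_le {E s t : ℝ} {l : ℕ} (h : l * (s - t) ≤ E) :
    (2 : ℝ) ^ (-E) * decay t l ≤ decay s l := by
  rw [decay, decay, ← Real.rpow_add two_pos]
  refine Real.rpow_le_rpow_of_exponent_le one_le_two ?_
  linarith

/-- A stage of the construction: the coefficients are final below `level`, and the smoothness
of the final function will be in `(bot, top]`. -/
structure Stage where
  /-- the location of the coefficient in each level -/
  loc : ℕ → ℕ
  /-- the coefficient in each level -/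
  coef : ℕ → ℝ
  /-- the first level that is not final -/
  level : ℕ
  /-- the smoothness of the present function -/
  top : ℝ
  /-- a lower bound for the smoothness of the final function -/
  bot : ℝ

namespace IntervalWaveletBasis

variable {φ ψ : ℝ → ℝ} {K N : ℕ} (W : IntervalWaveletBasis φ ψ N)

/-- The conditions under which a stage defines a self-similar function of smoothness `top`, and
may be continued to one of any smoothness between `bot` and `top`. -/
structure IsStage (ε M smin smax : ℝ) (ρ : ℕ → ℕ) (S : Stage) : Prop where
  adm : W.IsAdmissible S.loc
  even_level : Even S.level
  smin_lt : smin < S.bot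
  bot_lt : S.bot < S.top
  lt_smax : S.top < smax
  coef_le : ∀ l < S.level, W.j₀ < l → |S.coef l| ≤ M * decay S.top l
  coef_tail : ∀ l ≥ S.level, S.coef l = evenTail S.top M l
  window : ∀ j < S.level, W.j₀ < j → S.level ≤ ρ j * j ∨
    ∃ l, j ≤ l ∧ l ≤ ρ j * j ∧ l < S.level ∧ ε * M * decay S.bot l ≤ |S.coef l|
  two_le : ∀ j ≥ S.level, 2 ≤ ρ j

/-- The coefficients `(k, b)` agree with those of the stage `S` in its final levels. -/
structure Extends (smin M : ℝ) (S : Stage) (k : ℕ → ℕ) (b : ℕ → ℝ) : Prop where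
  adm : W.IsAdmissible k
  coef_le : ∀ l, W.j₀ < l → |b l| ≤ M * decay smin l
  agree : ∀ l < S.level, W.j₀ < l → k l = S.loc l ∧ b l = S.coef l

variable {W} {ε M smin smax : ℝ} {ρ : ℕ → ℕ} {S : Stage}

theorem IsStage.abs_coef_le (hS : W.IsStage ε M smin smax ρ S) (hM : 0 ≤ M) (l : ℕ)
    (hl : W.j₀ < l) : |S.coef l| ≤ M * decay S.top l := by
  rcases lt_or_ge l S.level with h | h
  · exact hS.coef_le l h hl
  · rw [hS.coef_tail l h]
    exact abs_evenTail_le hM l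

/-- In the tail one of `j`, `j + 1` is even and both are at most `2j`, so `ρ_j ≥ 2` suffices. An
earlier window contains a final level large enough for `bot`, hence for `top`, or reaches the tail
at the even level `S.level`. -/
theorem IsStage.exists_window (hS : W.IsStage ε M smin smax ρ S) (hε : ε ∈ Ioo (0 : ℝ) 1)
    (hM : 0 ≤ M) (j : ℕ) (hj : W.j₀ < j) :
    ∃ l, j ≤ l ∧ l ≤ ρ j * j ∧ ε * M * decay S.top l ≤ |S.coef l| := by
  have htail : ∀ l ≥ S.level, Even l → ε * M * decay S.top l ≤ |S.coef l| := fun l hl he => by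
    rw [hS.coef_tail l hl, abs_evenTail_of_even hM he]
    have := decay_pos S.top l
    gcongr
    exact mul_le_of_le_one_left hM hε.2.le
  rcases lt_or_ge j S.level with h | h
  · rcases hS.window j h hj with hw | ⟨l, h1, h2, -, h3⟩
    · exact ⟨S.level, h.le, hw, htail _ le_rfl hS.even_level⟩
    · refine ⟨l, h1, h2, le_trans ?_ h3⟩
      have := decay_anti hS.bot_lt.le l
      have := hε.1
      gcongr
  · have h2 : 2 * j ≤ ρ j * j := Nat.mul_le_mul_right j (hS.two_le j h)
    rcases Nat.even_or_odd j with he | ho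
    · exact ⟨j, le_rfl, by omega, htail j h he⟩
    · exact ⟨j + 1, by omega, by omega, htail _ (by omega) (by simpa using ho.add_one)⟩

theorem IsStage.mem_weaklySelfSimilar {C : ℝ} (hC : W.IsSizeBound C) (hC0 : 0 < C)
    (hS : W.IsStage ε M smin smax ρ S) (hε : ε ∈ Ioo (0 : ℝ) 1) (hM : 0 ≤ M) (hsmin : 0 < smin) :
    W.series M S.loc S.coef ∈ W.weaklySelfSimilar ε ρ S.top M :=
  series_mem_weaklySelfSimilar hC hC0 hS.adm hM (hsmin.trans (hS.smin_lt.trans hS.bot_lt))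
    (hS.abs_coef_le hM) hε (hS.exists_window hε hM)

/-- The stage that follows `S`, with a new wavelet at the location `i` in the level `c`. -/
noncomputable def nextStage (S : Stage) (M : ℝ) (c i level : ℕ) (top bot : ℝ) : Stage where
  loc := Function.update S.loc c i
  coef l := if l < level then Function.update S.coef c (M * decay top c) l else evenTail top M l
  level := level
  top := top
  bot := bot

/-- A window starting below `S.level` keeps its old witness or uses level `S.level`. One starting
before `a` uses an even level up to `a` of the old tail, by `hgap`; one starting in `[a, r a]` uses
the new wavelet, by `hgap'`; a later one reaches the new tail. The new wavelet sits in an odd level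
and so leaves the even ones untouched. -/
theorem isStage_nextStage (hS : W.IsStage ε M smin smax ρ S) (hε : ε ∈ Ioo (0 : ℝ) 1)
    (hM : 0 ≤ M) {a r β i : ℕ} {top bot E : ℝ} (hE : ε = (2 : ℝ) ^ (-E))
    (ha : Odd a) (hr : Odd r) (hβ : Even β) (hβ2 : 2 ≤ β) (hlevel : S.level ≤ a) (hj : W.j₀ < a)
    (hρr : ∀ j ≥ a, r ≤ ρ j) (hρβ : ∀ j ≥ a, β ≤ ρ j)
    (hi : N ≤ i) (hi' : i + N < 2 ^ (r * a))
    (hbot : S.bot < bot) (hbt : bot < top) (htop : top < S.top)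
    (hgap : a * (S.top - bot) ≤ E) (hgap' : ((r * a : ℕ) : ℝ) * (top - bot) ≤ E) :
    W.IsStage ε M smin smax ρ (nextStage S M (r * a) i (β * (r * a)) top bot) := by
  obtain ⟨r', hr'⟩ := hr
  have hrpos : 1 ≤ r := by omega
  have hac : a ≤ r * a := Nat.le_mul_of_pos_left a hrpos
  have hcodd : Odd (r * a) := Odd.mul ⟨r', hr'⟩ ha
  set c := r * a with hc
  have hcβ : 2 * c ≤ β * c := Nat.mul_le_mul_right c hβ2
  have ha0 : 0 < a := by omega
  have hcoefc : |M * decay top c| = M * decay top c :=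
    abs_of_nonneg (mul_nonneg hM (decay_pos _ _).le)
  constructor
  · intro l hl
    simp only [nextStage]
    rcases eq_or_ne l c with rfl | h
    · rw [Function.update_self]
      exact ⟨by omega, fun _ => ⟨hi, hi'⟩⟩
    · rw [Function.update_of_ne h]
      exact hS.adm l hl
  · exact hβ.mul_right c
  · exact hS.smin_lt.trans hbot
  · exact hbt
  · exact htop.trans hS.lt_smax
  · intro l hl hl0
    simp only [nextStage] at hl ⊢
    rw [if_pos hl]
    rcases eq_or_ne l c with rfl | h
    · rw [Function.update_self, hcoefc]
    · rw [Function.update_of_ne h]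
      refine (hS.abs_coef_le hM l hl0).trans ?_
      have := decay_anti htop.le l
      gcongr
  · intro l hl
    simp only [nextStage] at hl ⊢
    rw [if_neg (not_lt.2 hl)]
  · have hold : ∀ l, l < c → (nextStage S M c i (β * c) top bot).coef l = S.coef l := fun l hl => by
      simp only [nextStage]
      rw [if_pos (by omega), Function.update_of_ne hl.ne]
    have heven : ∀ l, S.level ≤ l → l ≤ a → Even l → l < β * c ∧
        ε * M * decay bot l ≤ |(nextStage S M c i (β * c) top bot).coef l| := by
      intro l h1 h2 h3
      have hne : l ≠ c := by
        rintro rfl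
        exact (Nat.not_even_iff_odd.2 hcodd) h3
      refine ⟨by omega, ?_⟩
      rw [hold l (by omega), hS.coef_tail l h1, abs_evenTail_of_even hM h3, hE, mul_right_comm,
        mul_comm M]
      refine mul_le_mul_of_nonneg_right (rpow_mul_decay_le (le_trans ?_ hgap)) hM
      have : (l : ℝ) ≤ a := by exact_mod_cast h2
      have : 0 ≤ S.top - bot := by linarith
      gcongr
    have hspike : ε * M * decay bot c ≤ |(nextStage S M c i (β * c) top bot).coef c| := by
      simp only [nextStage]
      rw [if_pos (by omega), Function.update_self, hcoefc, hE, mul_right_comm, mul_comm M]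
      exact mul_le_mul_of_nonneg_right (rpow_mul_decay_le hgap') hM
    intro j hjl hj0
    change j < β * c at hjl
    change β * c ≤ ρ j * j ∨ ∃ l, j ≤ l ∧ l ≤ ρ j * j ∧ l < β * c ∧
      ε * M * decay bot l ≤ |(nextStage S M c i (β * c) top bot).coef l|
    rcases lt_or_ge j S.level with h | h
    · right
      rcases hS.window j h hj0 with hw | ⟨l, h1, h2, h3, h4⟩
      · exact ⟨S.level, h.le, hw, heven _ le_rfl hlevel hS.even_level⟩
      · refine ⟨l, h1, h2, by omega, ?_⟩
        rw [hold l (by omega)]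
        refine le_trans ?_ h4
        have := decay_anti hbot.le l
        have := hε.1
        gcongr
    have h2j : 2 * j ≤ ρ j * j := Nat.mul_le_mul_right j (hS.two_le j h)
    rcases lt_or_ge j a with h' | h'
    · right
      rcases Nat.even_or_odd j with he | ho
      · exact ⟨j, le_rfl, by omega, heven j h h'.le he⟩
      · exact ⟨j + 1, by omega, by omega, heven _ (by omega) h' (by simpa using ho.add_one)⟩
    rcases le_or_gt j c with h'' | h''
    · exact Or.inr ⟨c, h'', Nat.mul_le_mul (hρr j h') h', by omega, hspike⟩
    · exact Or.inl (Nat.mul_le_mul (hρβ j h') h''.le)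
  · intro j hjl
    change β * c ≤ j at hjl
    exact hS.two_le j (by omega)

end IntervalWaveletBasis

/-! ### Failure of coverage at one stage -/

/-- Bands need not be measurable, so the good event is the complement of a measurable hull of the
bad set. Coverage costs `γ + δ` and the radius bound `δ`. -/
theorem exists_good_event {Q : ℕ → Measure PathSpace} [∀ n, IsProbabilityMeasure (Q n)]
    {C : ℕ → Band} {f : ℝ → ℝ} {r : ℕ → ℝ} {γ δ : ℝ} (hγ : 0 ≤ γ) (hδ : 0 < δ)
    (hcov : limsup (fun n => Q n {y | f ∉ (C n).toSet y}) atTop ≤ ENNReal.ofReal γ)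
    (hrad : IsBigOInProbability Q (fun n => (C n).radius) r) :
    ∃ D, 0 < D ∧ ∀ᶠ n in atTop, ∃ A, MeasurableSet A ∧ 1 - γ - 2 * δ ≤ (Q n).real A ∧
      ∀ y ∈ A, f ∈ (C n).toSet y ∧ (C n).radius y ≤ D * r n := by
  obtain ⟨D, hD, hDn⟩ := hrad δ hδ
  have hlt : limsup (fun n => Q n {y | f ∉ (C n).toSet y}) atTop < ENNReal.ofReal (γ + δ) :=
    hcov.trans_lt ((ENNReal.ofReal_lt_ofReal_iff (by linarith)).2 (by linarith))
  refine ⟨D, hD, ?_⟩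
  filter_upwards [hDn, eventually_lt_of_limsup_lt hlt] with n h1 h2
  set V := {y | f ∉ (C n).toSet y} ∪ {y | D * r n < |(C n).radius y|} with hV
  have hQV : Q n (toMeasurable (Q n) V) ≤ ENNReal.ofReal (γ + 2 * δ) := by
    rw [measure_toMeasurable]
    refine (measure_union_le _ _).trans ((add_le_add h2.le h1).trans ?_)
    rw [← ENNReal.ofReal_add (by linarith) hδ.le]
    exact ENNReal.ofReal_le_ofReal (by linarith)
  have hm := measurableSet_toMeasurable (Q n) V
  refine ⟨(toMeasurable (Q n) V)ᶜ, hm.compl, ?_, fun y hy => ?_⟩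
  · rw [probReal_compl_eq_one_sub hm]
    have : (Q n).real (toMeasurable (Q n) V) ≤ γ + 2 * δ :=
      ENNReal.toReal_le_of_le_ofReal (by linarith) hQV
    linarith
  · have hyV : y ∉ V := fun h => hy (subset_toMeasurable _ _ h)
    rw [hV, mem_union, not_or, mem_ofPred_eq, mem_ofPred_eq, not_not, not_lt] at hyV
    exact ⟨hyV.1, (le_abs_self _).trans hyV.2⟩

theorem Band.notMem_toSet {C : Band} {y : PathSpace} {f g : ℝ → ℝ} {R : ℝ}
    (hf : f ∈ C.toSet y) (hR : C.radius y ≤ R) {x : ℝ} (hx : x ∈ Icc (0 : ℝ) 1)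
    (hfg : 2 * R < |g x - f x|) : g ∉ C.toSet y := by
  intro hg
  have h1 := hf.2 x hx
  have h2 := hg.2 x hx
  have h3 : |g x - f x| ≤ |g x - C.center y x| + |f x - C.center y x| := by
    have h4 : g x - f x = (g x - C.center y x) - (f x - C.center y x) := by ring
    rw [h4]
    exact abs_sub _ _
  linarith

namespace IntervalWaveletBasis

variable {Ω : Type*} [MeasurableSpace Ω] {P : Measure Ω} {B : ℝ≥0 → Ω → ℝ}
  {φ ψ : ℝ → ℝ} {K N : ℕ} {W : IntervalWaveletBasis φ ψ N}
  {ε M smin smax : ℝ} {ρ : ℕ → ℕ} {S : Stage}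

/-- A band that is narrow around the function of the stage `S` misses every function that
extends the next stage. -/
theorem exists_location_of_good_event (hreg : IsRegularWavelet φ ψ K N) (hK : 0 < K)
    (hB : IsPreBrownianReal B P) (hBmeas : ∀ t, Measurable (B t)) {C : ℝ}
    (hC : W.IsSizeBound C) (hC0 : 0 < C) (hS : W.IsStage ε M smin smax ρ S) (hM : 0 < M)
    (hsmin : 0 < smin) {C' : Band} {n : ℕ} (hn : n ≠ 0) {A : Set PathSpace}
    (hA : MeasurableSet A) {R δ q : ℝ}
    (hQA : q ≤ (whiteNoiseLaw P B n (W.series M S.loc S.coef)).real A)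
    (hgood : ∀ y ∈ A, W.series M S.loc S.coef ∈ C'.toSet y ∧ C'.radius y ≤ R)
    {c level p : ℕ} (hc : W.j₀ < c) (hcodd : Odd c) (hclev : S.level ≤ c) (hlev : c < level)
    {top bot τ y : ℝ} (hsmintop : smin ≤ top)
    (hy : y ∈ Icc (1 - (K : ℝ)) K) (hp : 0 < p)
    (hpc : 2 * N + 2 * K + 2 * K * p ≤ 2 ^ c) (hτ : n * (M * decay top c) ^ 2 ≤ τ)
    (hδ1 : √((Real.exp τ - 1) / p) ≤ δ) {t : ℝ}
    (ht : t = 2 * M * C * (1 - (2 : ℝ) ^ (-smin))⁻¹ * ((2 : ℝ) ^ (-smin)) ^ level)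
    (hδ2 : √(Real.exp (n * t ^ 2) - 1) ≤ δ)
    (hsize : 2 * R + t < M * |ψ y| * (2 : ℝ) ^ (-((c : ℝ) * top))) :
    ∃ i, N ≤ i ∧ i + N < 2 ^ c ∧ ∀ k b, W.Extends smin M (nextStage S M c i level top bot) k b →
      ENNReal.ofReal (q - 2 * δ)
        ≤ whiteNoiseLaw P B n (W.series M k b) {y | W.series M k b ∉ C'.toSet y} := by
  have hSb : ∀ l, W.j₀ < l → |S.coef l| ≤ M * decay smin l := fun l hl => by
    refine (hS.abs_coef_le hM.le l hl).trans ?_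
    have := decay_anti (hS.smin_lt.trans hS.bot_lt).le l
    gcongr
  have hcont := continuousOn_series hC hC0 hS.adm hM.le hsmin hSb M
  obtain ⟨i, hi, hi', hmix⟩ := W.exists_hidden_wavelet hreg hK hB hBmeas hn hcont hc hp hpc hτ hA
  refine ⟨i, by omega, by omega, fun k b hkb => ?_⟩
  set f := W.series M S.loc S.coef with hf
  set g := W.series M k b with hg
  set k₁ := Function.update S.loc c i with hk₁
  set b₁ := Function.update S.coef c (M * decay top c) with hb₁
  -- The tail of `S` occupies only even levels, so the odd level `c` is free.
  have hSc : S.coef c = 0 := by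
    rw [hS.coef_tail c hclev, evenTail, if_neg (Nat.not_even_iff_odd.2 hcodd)]
  have hk₁adm : W.IsAdmissible k₁ := fun l hl => by
    rcases eq_or_ne l c with rfl | h
    · rw [hk₁, Function.update_self]
      exact ⟨by omega, fun _ => ⟨by omega, by omega⟩⟩
    · rw [hk₁, Function.update_of_ne h]
      exact hS.adm l hl
  have hb₁le : ∀ l, W.j₀ < l → |b₁ l| ≤ M * decay smin l := fun l hl => by
    rcases eq_or_ne l c with rfl | h
    · rw [hb₁, Function.update_self, abs_of_nonneg (mul_nonneg hM.le (decay_pos _ _).le)]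
      have := decay_anti hsmintop l
      gcongr
    · rw [hb₁, Function.update_of_ne h]
      exact hSb l hl
  have hf₁ : ∀ x ∈ Icc (0 : ℝ) 1, W.series M k₁ b₁ x = f x + M * decay top c * W.wav c i x :=
    fun x hx => series_update hC hC0 hS.adm hM.le hsmin hSb M hc hSc i _ hx
  -- Below `level` the next stage still carries the old coefficients, tail included, apart from the
  -- new wavelet. Hence `g` and `f` plus the wavelet differ only from `level` on.
  have hclose : ∀ x ∈ Icc (0 : ℝ) 1, |g x - W.series M k₁ b₁ x| ≤ t := fun x hx => by
    rw [ht]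
    refine abs_series_sub_series_le hC hC0 hkb.adm hk₁adm hM.le hsmin hkb.coef_le hb₁le M
      (fun l hl hl0 => ?_) hx
    have h := hkb.agree l hl hl0
    simp only [nextStage] at h hl
    rwa [if_pos hl] at h
  have hgcont : ContinuousOn g (Icc 0 1) :=
    continuousOn_series hC hC0 hkb.adm hM.le hsmin hkb.coef_le M
  have hshift := whiteNoiseLaw_le_shift hB hBmeas hn
    (continuousOn_series hC hC0 hk₁adm hM.le hsmin hb₁le M) hgcont hclose hA
  rw [whiteNoiseLaw_congr hf₁] at hshift
  have hfinal : q - 2 * δ ≤ (whiteNoiseLaw P B n g).real A := by linarith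
  have hprob := isProbabilityMeasure_whiteNoiseLaw hB hBmeas n g
  calc ENNReal.ofReal (q - 2 * δ) ≤ ENNReal.ofReal ((whiteNoiseLaw P B n g).real A) :=
        ENNReal.ofReal_le_ofReal hfinal
    _ = whiteNoiseLaw P B n g A := ofReal_measureReal
    _ ≤ _ := measure_mono fun z hz => ?_
  obtain ⟨x, hx, hwx⟩ := W.exists_wav_eq hy hK hc hi hi'
  refine Band.notMem_toSet (hgood z hz).1 (hgood z hz).2 hx ?_
  have h1 := hclose x hx
  rw [hf₁ x hx, hwx] at h1
  have h2 : M * decay top c * ((2 : ℝ) ^ ((c : ℝ) / 2) * ψ y)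
      = M * ψ y * (2 : ℝ) ^ (-((c : ℝ) * top)) := by
    have h3 := rpow_half_mul_decay top c
    rw [← Real.rpow_natCast, ← Real.rpow_mul two_pos.le,
      show -top * (c : ℝ) = -((c : ℝ) * top) by ring] at h3
    rw [← h3]
    ring
  rw [h2] at h1
  have h4 : |M * ψ y * (2 : ℝ) ^ (-((c : ℝ) * top))| = M * |ψ y| * (2 : ℝ) ^ (-((c : ℝ) * top)) := by
    rw [abs_mul, abs_mul, abs_of_pos hM, abs_of_pos (two_rpow_pos _)]
  have h5 : |M * ψ y * (2 : ℝ) ^ (-((c : ℝ) * top))|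
      ≤ |g x - f x| + |g x - (f x + M * ψ y * (2 : ℝ) ^ (-((c : ℝ) * top)))| := by
    have h6 : M * ψ y * (2 : ℝ) ^ (-((c : ℝ) * top))
        = (g x - f x) - (g x - (f x + M * ψ y * (2 : ℝ) ^ (-((c : ℝ) * top)))) := by ring
    rw [h6]
    refine (abs_sub _ _).trans (le_of_eq ?_)
    rw [← h6]
  linarith

end IntervalWaveletBasis

namespace IntervalWaveletBasis

variable {Ω : Type*} [MeasurableSpace Ω] {P : Measure Ω} {B : ℝ≥0 → Ω → ℝ}
  {φ ψ : ℝ → ℝ} {K N : ℕ} {W : IntervalWaveletBasis φ ψ N}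
  {ε M smin smax : ℝ} {ρ : ℕ → ℕ}

/-! ### The sequence of stages and its limit -/

/-- The stage `S'` continues the stage `S`. -/
structure _root_.WaveletBand.Stage.Continues (S S' : Stage) : Prop where
  level_lt : S.level < S'.level
  bot_lt : S.bot < S'.bot
  top_lt : S'.top < S.top
  agree : ∀ l < S.level, S'.loc l = S.loc l ∧ S'.coef l = S.coef l

theorem nextStage_continues {S : Stage} {c i level : ℕ} {top bot : ℝ} (hc : S.level ≤ c)
    (hlevel : c < level) (hbot : S.bot < bot) (htop : top < S.top) :
    S.Continues (nextStage S M c i level top bot) where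
  level_lt := hc.trans_lt hlevel
  bot_lt := hbot
  top_lt := htop
  agree l hl := by
    have hne : l ≠ c := (hl.trans_le hc).ne
    simp only [nextStage]
    rw [if_pos (hl.trans (hc.trans_lt hlevel)), Function.update_of_ne hne,
      Function.update_of_ne hne]
    exact ⟨rfl, rfl⟩

/-- While `ρ_j` may still be 1, a window can consist of level `j` alone; all levels are therefore
filled until `ρ_j ≥ 2` allows the even levels to suffice. -/
theorem exists_stage (W : IntervalWaveletBasis φ ψ N) (hε : ε ∈ Ioo (0 : ℝ) 1) (hM : 0 ≤ M)
    (hρ_pos : ∀ j ≥ W.j₀, 1 ≤ ρ j) (hρ : Tendsto ρ atTop atTop) (hs : smin < smax) :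
    ∃ S, W.IsStage ε M smin smax ρ S := by
  obtain ⟨J, hJ⟩ := eventually_atTop.1 (hρ.eventually_ge_atTop 2)
  have hE0 : 0 < -Real.logb 2 ε := neg_pos.2 (Real.logb_neg one_lt_two hε.1 hε.2)
  have hE : ε = (2 : ℝ) ^ (-(-Real.logb 2 ε)) := by
    rw [neg_neg, Real.rpow_logb two_pos (by norm_num) hε.1]
  set E := -Real.logb 2 ε
  set Λ := 2 * J with hΛ
  set top := (smin + 2 * smax) / 3 with htop
  -- The first term makes `l η ≤ E` for all `l < Λ`, so these coefficients stay large enough down to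
  -- smoothness `bot`; the second keeps `bot` above `smin`.
  set η := min (E / (Λ + 1)) ((smax - smin) / 3) with hη
  have hη0 : 0 < η := lt_min (by positivity) (by linarith)
  have hη1 : (Λ + 1 : ℝ) * η ≤ E := by
    have := min_le_left (E / (Λ + 1)) ((smax - smin) / 3)
    rw [← hη, le_div_iff₀ (by positivity)] at this
    linarith
  have hη2 : η ≤ (smax - smin) / 3 := min_le_right _ _
  refine ⟨⟨fun l => if N < l then N else 0,
    fun l => if l < Λ then M * decay top l else evenTail top M l, Λ, top, top - η⟩, ?_⟩
  constructor
  · intro l _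
    rcases lt_or_ge N l with h | h
    · simp only [if_pos h]
      have h1 : N < 2 ^ N := Nat.lt_two_pow_self
      have h2 : 2 ^ (N + 1) ≤ 2 ^ l := Nat.pow_le_pow_right two_pos h
      rw [pow_succ] at h2
      exact ⟨by omega, fun _ => ⟨le_rfl, by omega⟩⟩
    · simp only [if_neg (not_lt.2 h)]
      exact ⟨by positivity, fun h' => absurd h' (not_lt.2 h)⟩
  · exact ⟨J, by simp only [hΛ]; ring⟩
  · simp only; linarith
  · simp only; linarith
  · simp only; linarith
  · intro l hl _
    simp only at hl ⊢
    rw [if_pos hl, abs_of_nonneg (mul_nonneg hM (decay_pos _ _).le)]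
  · intro l hl
    simp only at hl ⊢
    rw [if_neg (not_lt.2 hl)]
  · intro j hj hj0
    simp only at hj ⊢
    refine Or.inr ⟨j, le_rfl, Nat.le_mul_of_pos_left j (hρ_pos j hj0.le), hj, ?_⟩
    rw [if_pos hj, abs_of_nonneg (mul_nonneg hM (decay_pos _ _).le), hE, mul_right_comm,
      mul_comm M]
    refine mul_le_mul_of_nonneg_right (rpow_mul_decay_le ?_) hM
    have h1 : (j : ℝ) ≤ Λ := by exact_mod_cast hj.le
    nlinarith
  · intro j hj
    simp only at hj
    exact hJ j (by omega)

section Limit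

variable {S : ℕ → Stage}

theorem stage_agree (hcont : ∀ m, (S m).Continues (S (m + 1))) {m m' : ℕ} (h : m ≤ m') {l : ℕ}
    (hl : l < (S m).level) : (S m').loc l = (S m).loc l ∧ (S m').coef l = (S m).coef l := by
  have hlevel : StrictMono fun m => (S m).level := strictMono_nat_of_lt_succ fun m =>
    (hcont m).level_lt
  induction m', h using Nat.le_induction with
  | base => exact ⟨rfl, rfl⟩
  | succ n hmn ih =>
    have h1 := (hcont n).agree l (hl.trans_le (hlevel.monotone hmn))
    exact ⟨h1.1.trans ih.1, h1.2.trans ih.2⟩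

/-- A sequence of stages has a self-similar limit, which extends all of them. -/
theorem exists_limit {C : ℝ} (hC : W.IsSizeBound C) (hC0 : 0 < C) (hε : ε ∈ Ioo (0 : ℝ) 1)
    (hM : 0 ≤ M) (hsmin : 0 < smin) (hS : ∀ m, W.IsStage ε M smin smax ρ (S m))
    (hcont : ∀ m, (S m).Continues (S (m + 1))) :
    ∃ s ∈ Ioo smin smax, ∃ k b, W.series M k b ∈ W.weaklySelfSimilar ε ρ s M ∧
      ∀ m, W.Extends smin M (S m) k b := by
  have hlevel : StrictMono fun m => (S m).level := strictMono_nat_of_lt_succ fun m =>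
    (hcont m).level_lt
  have hbot : StrictMono fun m => (S m).bot := strictMono_nat_of_lt_succ fun m =>
    (hcont m).bot_lt
  have htop : StrictAnti fun m => (S m).top := strictAnti_nat_of_succ_lt fun m =>
    (hcont m).top_lt
  have hbt : ∀ m m', (S m).bot ≤ (S m').top := fun m m' =>
    (hbot.monotone (le_max_left m m')).trans
      ((hS _).bot_lt.le.trans (htop.antitone (le_max_right m m')))
  have hbdd : BddAbove (range fun m => (S m).bot) := ⟨(S 0).top, by
    rintro _ ⟨m, rfl⟩
    exact hbt m 0⟩
  -- Every lower bound is at most every `top`, so `s` lies between them at all stages. This gives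
  -- the upper bounds on coefficients from `top` and the windows from `bot`.
  set s := ⨆ m, (S m).bot with hs
  have hbs : ∀ m, (S m).bot ≤ s := fun m => le_ciSup hbdd m
  have hst : ∀ m, s ≤ (S m).top := fun m => ciSup_le fun m' => hbt m' m
  have hmins : smin < s := (hS 0).smin_lt.trans_le (hbs 0)
  have hlt : ∀ l, l < (S (l + 1)).level := fun l =>
    (Nat.lt_succ_self l).trans_le (hlevel.le_apply (x := l + 1))
  set k : ℕ → ℕ := fun l => (S (l + 1)).loc l with hk
  set b : ℕ → ℝ := fun l => (S (l + 1)).coef l with hb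
  have hagree : ∀ m, ∀ l < (S m).level, k l = (S m).loc l ∧ b l = (S m).coef l := by
    intro m l hl
    have h1 := stage_agree hcont (le_max_left m (l + 1)) hl
    have h2 := stage_agree hcont (le_max_right m (l + 1)) (hlt l)
    exact ⟨h2.1.symm.trans h1.1, h2.2.symm.trans h1.2⟩
  have hadm : W.IsAdmissible k := fun l hl => (hS (l + 1)).adm l hl
  have hle : ∀ l, W.j₀ < l → |b l| ≤ M * decay s l := fun l hl => by
    refine ((hS (l + 1)).abs_coef_le hM l hl).trans ?_
    have := decay_anti (hst (l + 1)) l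
    gcongr
  refine ⟨s, ⟨hmins, (hst 0).trans_lt (hS 0).lt_smax⟩, k, b, ?_, fun m => ⟨hadm, fun l hl => ?_,
    fun l hl _ => hagree m l hl⟩⟩
  · refine series_mem_weaklySelfSimilar hC hC0 hadm hM (hsmin.trans hmins) hle hε fun j hj => ?_
    -- At a stage this late the whole window is final, which rules out the alternative that it
    -- reaches the tail.
    set m := max (j + 1) (ρ j * j + 1) with hm
    have hml : m ≤ (S m).level := hlevel.le_apply
    rcases (hS m).window j (by omega) hj with h | ⟨l, h1, h2, h3, h4⟩
    · omega
    · refine ⟨l, h1, h2, ?_⟩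
      rw [(hagree m l h3).2]
      refine le_trans ?_ h4
      have := decay_anti (hbs m) l
      have := hε.1
      gcongr
  · refine (hle l hl).trans ?_
    have := decay_anti hmins.le l
    gcongr

end Limit

/-! ### Passing from one stage to the next -/

theorem exists_next_stage (hmra : IsOrthonormalMRA φ ψ) (hreg : IsRegularWavelet φ ψ K N)
    (hB : IsPreBrownianReal B P) (hBmeas : ∀ t, Measurable (B t)) {C : ℝ}
    (hC : W.IsSizeBound C) (hC0 : 0 < C) (hε : ε ∈ Ioo (0 : ℝ) 1) (hρ : Tendsto ρ atTop atTop)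
    {γ : ℝ} (hγ : γ ∈ Ioo (0 : ℝ) (1 / 2)) (hsmin : 0 < smin) (hM : 0 < M) {C' : ℕ → Band}
    (hcov : ∀ f ∈ ⋃ s ∈ Ioo smin smax, W.weaklySelfSimilar ε ρ s M,
      limsup (fun n : ℕ => whiteNoiseLaw P B n f {y | f ∉ (C' n).toSet y}) atTop
        ≤ ENNReal.ofReal γ)
    (hrad : ∀ s ∈ Ioo smin smax, ∀ f ∈ W.weaklySelfSimilar ε ρ s M,
      IsBigOInProbability (fun n => whiteNoiseLaw P B n f) (fun n => (C' n).radius) (rate s))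
    {S : Stage} (hS : W.IsStage ε M smin smax ρ S) (n₀ : ℕ) :
    ∃ S' n, W.IsStage ε M smin smax ρ S' ∧ S.Continues S' ∧ n₀ ≤ n ∧
      ∀ k b, W.Extends smin M S' k b → ENNReal.ofReal (1 / 2)
        ≤ whiteNoiseLaw P B n (W.series M k b) {y | W.series M k b ∉ (C' n).toSet y} := by
  obtain ⟨y, hy, hψy⟩ := hreg.exists_ne_zero hmra
  have hK : 0 < K := by
    have h : (0 : ℝ) < K := by linarith [hy.1, hy.2]
    exact_mod_cast h
  set s := S.top with hs
  have hsI : s ∈ Ioo smin smax := ⟨hS.smin_lt.trans hS.bot_lt, hS.lt_smax⟩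
  have hs0 : 0 < s := hsmin.trans hsI.1
  have hf := hS.mem_weaklySelfSimilar hC hC0 hε hM.le hsmin
  -- Four losses of `δ` occur: two in the good event, one in hiding the wavelet and one in the tail.
  -- This value gives `1 - γ - 4δ = 1/2`.
  set δ := (1 - 2 * γ) / 8 with hδ
  have hδ0 : 0 < δ := by have := hγ.2; rw [hδ]; linarith
  have hprob : ∀ n, IsProbabilityMeasure (whiteNoiseLaw P B n (W.series M S.loc S.coef)) :=
    fun n => isProbabilityMeasure_whiteNoiseLaw hB hBmeas n _
  obtain ⟨D, hD, hgood⟩ := exists_good_event hγ.1.le hδ0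
    (hcov _ (mem_iUnion₂.2 ⟨s, hsI, hf⟩)) (hrad s hsI _ hf)
  obtain ⟨n₁, hn₁⟩ := eventually_atTop.1 hgood
  have hE0 : 0 < -Real.logb 2 ε := neg_pos.2 (Real.logb_neg one_lt_two hε.1 hε.2)
  have hE : ε = (2 : ℝ) ^ (-(-Real.logb 2 ε)) := by
    rw [neg_neg, Real.rpow_logb two_pos (by norm_num) hε.1]
  set E := -Real.logb 2 ε
  obtain ⟨β₀, hβ₀⟩ := exists_nat_ge ((smax + 2) / smin)
  set β := 2 * (β₀ + 1) with hβ
  have hβs : smax + 2 ≤ β * smin := by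
    rw [div_le_iff₀ hsmin] at hβ₀
    have h0 : (0 : ℝ) ≤ β₀ := Nat.cast_nonneg _
    rw [hβ]
    push_cast
    nlinarith
  set T := 2 * M * C * (1 - (2 : ℝ) ^ (-smin))⁻¹ with hT
  have hT0 : 0 ≤ T := by
    have := two_rpow_neg_lt_one hsmin
    have : 0 ≤ (1 - (2 : ℝ) ^ (-smin))⁻¹ := inv_nonneg.2 (by linarith)
    positivity
  obtain ⟨r₀, hr₀⟩ := exists_scales hs0 hsI.2.le hM hD hδ0 hE0 (abs_pos.2 hψy) hT0
    (max n₀ n₁) N hK hβs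
  -- Both `r` and `a` are odd, so that `c = r a` is an odd level. The order matters: `r` depends on
  -- `D`, and only then is `a` taken so large that `ρ_j ≥ max r β` from `a` on.
  set r := 2 * r₀ + 1 with hr
  have hmulr : Tendsto (fun a : ℕ => r * a) atTop atTop :=
    tendsto_id.const_mul_atTop' (by omega)
  have hev : ∀ᶠ a : ℕ in atTop, E / (s - S.bot) < a :=
    tendsto_natCast_atTop_atTop.eventually_gt_atTop _
  obtain ⟨a₀, ha₀⟩ := eventually_atTop.1 ((hmulr.eventually (hr₀ r (by omega))).and
    ((eventually_ge_atTop S.level).and ((eventually_gt_atTop W.j₀).and hev)))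
  obtain ⟨a₁, ha₁⟩ := eventually_atTop.1 (hρ.eventually_ge_atTop (max r β))
  set a := 2 * (a₀ + a₁) + 1 with ha
  obtain ⟨⟨n, p, τ, hn, hn0, hp, hpc, hτ, hδ1, hδ2, hsize⟩, hlevel, hja, hEa⟩ :=
    ha₀ a (by omega)
  set c := r * a with hc
  have hac : a ≤ c := Nat.le_mul_of_pos_left a (by omega)
  have hapos : (0 : ℝ) < a := by exact_mod_cast (show 0 < a by omega)
  have hcpos : (0 : ℝ) < c := by exact_mod_cast (show 0 < c by omega)
  have hrpos : (0 : ℝ) < r := by exact_mod_cast (show 0 < r by omega)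
  have hcac : (c : ℝ) = r * a := by rw [hc]; push_cast; ring
  have hac' : (a : ℝ) ≤ c := by exact_mod_cast hac
  have hEra : E * r / (2 * c) = E / (2 * a) := by
    rw [hcac]
    field_simp
  have hEc : E / (2 * c) ≤ E / (2 * a) := by gcongr
  have hEac : E / (2 * a) + E / (2 * a) < s - S.bot := by
    have hsb : 0 < s - S.bot := sub_pos.2 hS.bot_lt
    rw [div_lt_iff₀ hsb] at hEa
    rw [← add_div, ← two_mul, mul_div_mul_left _ _ two_ne_zero, div_lt_iff₀ hapos]
    linarith
  have hE2a : 0 < E / (2 * a) := by positivity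
  have hE2c : 0 < E / (2 * c) := by positivity
  set top := s - E * r / (2 * c) with htop
  -- The drop from `s` to `top` is `E/(2a)` and that from `top` to `bot` is `E/(2c) ≤ E/(2a)`.
  -- Together they cost at most the slack `E` in levels up to `a`, and the second costs `E/2` in
  -- level `c`.
  set bot := top - E / (2 * c) with hbot
  have htop' : top < s := by rw [htop, hEra]; linarith
  have hbot' : S.bot < bot := by rw [hbot, htop, hEra]; linarith
  have hbt : bot < top := by rw [hbot]; linarith
  have hcodd : Odd c := Odd.mul ⟨r₀, hr⟩ ⟨a₀ + a₁, ha⟩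
  have hcβ : 2 * c ≤ β * c := Nat.mul_le_mul_right c (by omega)
  obtain ⟨A, hA, hQA, hAgood⟩ := hn₁ n ((le_max_right _ _).trans hn)
  obtain ⟨i, hi, hi', hmiss⟩ := exists_location_of_good_event hreg hK hB hBmeas hC hC0 hS hM hsmin
    hn0 hA hQA hAgood (c := c) (level := β * c) (bot := bot) (by omega) hcodd
    (by omega) (by omega) ((hS.smin_lt.trans (hbot'.trans hbt)).le) hy hp hpc hτ hδ1 rfl hδ2 hsize
  refine ⟨nextStage S M c i (β * c) top bot, n, ?_, ?_, (le_max_left _ _).trans hn,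
    fun k b hkb => ?_⟩
  · refine isStage_nextStage hS hε hM.le hE ⟨a₀ + a₁, ha⟩ ⟨r₀, hr⟩ ⟨β₀ + 1, by omega⟩ (by omega)
      hlevel hja (fun j hj => (le_max_left _ _).trans (ha₁ j (by omega)))
      (fun j hj => (le_max_right _ _).trans (ha₁ j (by omega))) hi hi' hbot' hbt htop' ?_ ?_
    · have h1 : S.top - bot ≤ E / (2 * a) + E / (2 * a) := by
        rw [hbot, htop, hEra]; linarith
      calc (a : ℝ) * (S.top - bot) ≤ a * (E / (2 * a) + E / (2 * a)) := by gcongr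
        _ = E := by field_simp; ring
    · rw [← hc]
      have h1 : top - bot = E / (2 * c) := by rw [hbot]; ring
      rw [h1]
      have h2 : (c : ℝ) * (E / (2 * c)) = E / 2 := by field_simp
      rw [h2]
      linarith
  · exact nextStage_continues (by omega) (by omega) hbot' htop'
  · refine le_trans (ENNReal.ofReal_le_ofReal ?_) (hmiss k b hkb)
    rw [hδ]
    linarith

end IntervalWaveletBasis

end WaveletBand

theorem mainTheorem3
    {φ ψ : ℝ → ℝ} {K N : ℕ}
    (hmra : WaveletBand.IsOrthonormalMRA φ ψ) (hreg : WaveletBand.IsRegularWavelet φ ψ K N)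
    (W : WaveletBand.IntervalWaveletBasis φ ψ N)
    {Ω : Type*} [MeasurableSpace Ω] (P : Measure Ω) (B : ℝ≥0 → Ω → ℝ)
    (hB : IsBrownianReal B P) (hBmeas : ∀ t, Measurable (B t))
    (smax : ℝ) (hsmax : smax ∈ Ioo (0 : ℝ) N)
    (ε : ℝ) (hε : ε ∈ Ioo (0 : ℝ) 1)
    (ρ : ℕ → ℕ) (hρ_pos : ∀ j ≥ W.j₀, 1 ≤ ρ j) (hρ : Tendsto ρ atTop atTop)
    (γ : ℝ) (hγ : γ ∈ Ioo (0 : ℝ) (1 / 2))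
    (smin : ℝ) (hsmin : smin ∈ Ioo 0 smax)
    (M : ℝ) (hM : 0 < M)
    (C : ℕ → WaveletBand.Band) :
    ¬ ((∀ f ∈ ⋃ s ∈ Ioo smin smax, W.weaklySelfSimilar ε ρ s M,
          limsup (fun n : ℕ => WaveletBand.whiteNoiseLaw P B n f {y | f ∉ (C n).toSet y}) atTop
            ≤ ENNReal.ofReal γ) ∧
        (∀ s ∈ Ioo smin smax, ∀ f ∈ W.weaklySelfSimilar ε ρ s M,
          WaveletBand.IsBigOInProbability (fun n => WaveletBand.whiteNoiseLaw P B n f)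
            (fun n => (C n).radius) (WaveletBand.rate s))) := by
  rintro ⟨hcov, hrad⟩
  obtain ⟨c, hc0, hc⟩ := W.exists_isSizeBound hreg
  obtain ⟨S₀, hS₀⟩ := W.exists_stage hε hM.le hρ_pos hρ hsmin.2
  -- Stage `m` is continued with the requirement `n ≥ m`, which makes the times of failure
  -- unbounded.
  choose! next time hnext hcont htime hmiss using fun (S : WaveletBand.Stage)
    (hS : W.IsStage ε M smin smax ρ S) (n₀ : ℕ) =>
      WaveletBand.IntervalWaveletBasis.exists_next_stage hmra hreg hB.toIsPreBrownianReal hBmeas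
        hc hc0 hε hρ hγ hsmin.1 hM hcov hrad hS n₀
  set S : ℕ → WaveletBand.Stage := fun m => Nat.rec S₀ (fun m S => next S m) m with hSdef
  have hS : ∀ m, W.IsStage ε M smin smax ρ (S m) := fun m => by
    induction m with
    | zero => exact hS₀
    | succ m ih => exact hnext (S m) ih m
  obtain ⟨s, hs, k, b, hf, hext⟩ := WaveletBand.IntervalWaveletBasis.exists_limit hc hc0 hε hM.le
    hsmin.1 hS fun m => hcont (S m) (hS m) m
  have hfreq : ∃ᶠ n in atTop, ENNReal.ofReal (1 / 2) ≤ WaveletBand.whiteNoiseLaw P B n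
      (W.series M k b) {y | W.series M k b ∉ (C n).toSet y} :=
    frequently_atTop.2 fun m => ⟨time (S m) m, htime (S m) (hS m) m,
      hmiss (S m) (hS m) m k b (hext (m + 1))⟩
  -- The limit extends every stage, so it inherits all the failures of coverage while lying in the
  -- class itself.
  have hle := (le_limsup_of_frequently_le hfreq).trans (hcov _ (mem_iUnion₂.2 ⟨s, hs, hf⟩))
  rw [ENNReal.ofReal_le_ofReal_iff hγ.1.le] at hle
  linarith [hγ.2]
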